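/- **Setting.** Let $G$ be a connected semisimple real algebraic group (the identity component of the group of real points of a semisimple linear algebraic group over $\mathbb R$) and $\Gamma<G$ a torsion-free discrete subgroup. Fix a maximal compact subgroup $K<G$ with Cartan involution $\theta$ and Cartan decomposition $\mathfrak g=\mathfrak k\oplus\mathfrak p$, a maximal abelian subspace $\mathfrak a\subset\mathfrak p$, a closed positive Weyl chamber $\mathfrak a^+\subset\mathfrak a$, and an element $w_0\in K$ normalizing $\mathfrak a$ with $\mathrm{Ad}_{w_0}\mathfrak a^+=-\mathfrak a^+$. Let $A=\exp\mathfrak a$, $N=\exp\mathfrak n$ with $\mathfrak n$ the sum of the positive root spaces, $M$ the centralizer of $A$ in $K$, and $P=MAN$. Let $X=G/K$ with $o=[K]$, with the Riemannian distance $d$ induced by the Killing form and the Riemannian volume $\mathrm{vol}$; let $d$ and $\mathrm{vol}$ also denote the induced distance and volume on $\Gamma\backslash X$. Let $\mathcal F=G/P$, and $g^+=gP$, $g^-=gw_0P$ for $g\in G$. Let $H:G\to\mathfrak a$ be the Iwasawa cocycle, $g\in K\exp(H(g))N$, and let $\beta_{hP}(go,g'o)=H(g^{-1}h)-H(g'^{-1}h)\in\mathfrak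 a$ be the Busemann map. For $\psi\in\mathfrak a^*$, a $(\Gamma,\psi)$-conformal density is a family $\nu=\{\nu_x:x\in X\}$ of finite Borel measures on $\mathcal F$ with $\frac{d\nu_x}{d\nu_y}(\xi)=e^{-\psi(\beta_\xi(x,y))}$ and $\gamma_*\nu_x=\nu_{\gamma x}$ for all $x,y\in X$, $\xi\in\mathcal F$, $\gamma\in\Gamma$. It defines the function $E_\nu([x])=|\nu_x|=\nu_x(\mathcal F)$ on $\Gamma\backslash X$. Given a $(\Gamma,\psi_1)$-conformal density $\nu$ and a $(\Gamma,\psi_2)$-conformal density $\bar\nu$, let $\tilde m_{\nu,\bar\nu}$ be the measure on $G/M$ which, in the Hopf coordinates $gM\mapsto(g^+,g^-,v=\beta_{g^-}(o,go))$, is given by $$d\tilde m_{\nu,\bar\nu}(gM)=e^{\psi_1(\beta_{g^+}(o,go))+\psi_2(\beta_{g^-}(o,go))}\,d\nu_o(g^+)\,d\bar\nu_o(g^-)\,dv,$$ where $dv$ is Lebesgue measure on $\mathfrak a$. Lift it to a right $M$-invariant measure on $G$ by means of the Haar probability measure of $M$, and let $m_{\nu,\bar\nu}$ be the measure on $\Gamma\backslash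 G$ induced by this left $\Gamma$-invariant measure (the generalized Bowen–Margulis–Sullivan measure). **Theorem (Smearing theorem).** For any $\psi_1,\psi_2\in\mathfrak a^*$, any $(\Gamma,\psi_1)$-conformal density $\nu$ and any $(\Gamma,\psi_2)$-conformal density $\bar\nu$ on $\mathcal F$, there exists $c>0$ such that $$m_{\nu,\bar\nu}(\Gamma\backslash G)\le c\int_{\mathcal N} E_\nu(x)\,E_{\bar\nu}(x)\,d\mathrm{vol}(x),$$ where $\mathcal N\subset\Gamma\backslash X$ is the one-neighborhood of $\operatorname{supp} m_{\nu,\bar\nu}$, that is, the set of points of $\Gamma\backslash X$ at distance less than $1$ from the image of $\operatorname{supp} m_{\nu,\bar\nu}$ in $\Gamma\backslash X$. Both sides may be infinite. -/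

import Mathlib

open MeasureTheory Topology
open scoped ENNReal Matrix

attribute [local instance] LieRing.ofAssociativeRing

noncomputable section

namespace Smearing

/-! ### Connected semisimple real algebraic groups -/

variable {n : ℕ}

/-- `H` is the group of real points of a linear algebraic group: it is cut out in `GL_n(ℝ)` by
polynomial equations in the matrix entries. -/
def IsRealAlgebraic (H : Subgroup (GL (Fin n) ℝ)) : Prop :=
  ∃ S : Set (MvPolynomial (Fin n × Fin n) ℝ), ∀ g : GL (Fin n) ℝ,
    g ∈ H ↔ ∀ p ∈ S, MvPolynomial.eval (fun ij => (g : Matrix (Fin n) (Fin n) ℝ) ij.1 ij.2) p = 0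

/-- The identity component of a subgroup of `GL_n(ℝ)`. -/
def identityComponent (H : Subgroup (GL (Fin n) ℝ)) : Subgroup (GL (Fin n) ℝ) :=
  (Subgroup.connectedComponentOfOne H).map H.subtype

/-- The Lie algebra of `G ≤ GL_n(ℝ)`: all `X` with `exp (tX) ∈ G` for every real `t`. (For closed
`G` these matrices already form a Lie algebra, so that taking the span adds nothing.) -/
def lieAlg (G : Subgroup (GL (Fin n) ℝ)) : LieSubalgebra ℝ (Matrix (Fin n) (Fin n) ℝ) :=
  LieSubalgebra.lieSpan ℝ _
    {X | ∀ t : ℝ, ∃ g ∈ G, (g : Matrix (Fin n) (Fin n) ℝ) = NormedSpace.exp (t • X)}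

/-- `G` is a connected semisimple real algebraic group: the identity component of the group of
real points of a linear algebraic group over `ℝ`, with semisimple Lie algebra. -/
def IsConnectedSemisimpleAlgebraic (G : Subgroup (GL (Fin n) ℝ)) : Prop :=
  (∃ H : Subgroup (GL (Fin n) ℝ), IsRealAlgebraic H ∧ G = identityComponent H) ∧
    LieAlgebra.IsSemisimple ℝ (lieAlg G)

instance (G : Subgroup (GL (Fin n) ℝ)) : MeasurableSpace G := borel G

instance (G : Subgroup (GL (Fin n) ℝ)) : BorelSpace G := ⟨rfl⟩

/-- The matrix underlying an element of `G`. -/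
def toMat {G : Subgroup (GL (Fin n) ℝ)} (g : G) : Matrix (Fin n) (Fin n) ℝ :=
  ((g : GL (Fin n) ℝ) : Matrix (Fin n) (Fin n) ℝ)

/-! ### The choices: maximal compact subgroup, split torus, Weyl chamber, longest Weyl element -/

/-- The restricted root space of a linear form `α` on a subspace `𝔞` of a Lie algebra. -/
def rootSpace {𝔤 : Type*} [LieRing 𝔤] [LieAlgebra ℝ 𝔤] (𝔞 : Submodule ℝ 𝔤)
    (α : Module.Dual ℝ 𝔞) : Submodule ℝ 𝔤 where
  carrier := {X | ∀ H : 𝔞, ⁅(H : 𝔤), X⁆ = α H • X}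
  add_mem' := by
    intro X Y hX hY H
    rw [lie_add, hX H, hY H, smul_add]
  zero_mem' := by
    intro H
    rw [lie_zero, smul_zero]
  smul_mem' := by
    intro c X hX H
    rw [lie_smul, hX H, smul_comm]

/-- `α` is a restricted root of `(𝔤, 𝔞)`. -/
def IsRoot {𝔤 : Type*} [LieRing 𝔤] [LieAlgebra ℝ 𝔤] (𝔞 : Submodule ℝ 𝔤)
    (α : Module.Dual ℝ 𝔞) : Prop :=
  α ≠ 0 ∧ rootSpace 𝔞 α ≠ ⊥

/-- The closed Weyl chamber containing the regular element `H₀`: the positive roots are those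
which are positive at `H₀`. -/
def weylChamber {𝔤 : Type*} [LieRing 𝔤] [LieAlgebra ℝ 𝔤] (𝔞 : Submodule ℝ 𝔤) (H₀ : 𝔞) : Set 𝔞 :=
  {v | ∀ α : Module.Dual ℝ 𝔞, IsRoot 𝔞 α → 0 < α H₀ → 0 ≤ α v}

/-- The data fixed once and for all in a connected semisimple real algebraic group `G`. -/
structure CartanData (G : Subgroup (GL (Fin n) ℝ)) where
  /-- the maximal compact subgroup `K` -/
  K : Subgroup G
  isCompact_K : IsCompact (K : Set G)
  maximal_K : ∀ L : Subgroup G, IsCompact (L : Set G) → K ≤ L → L = K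
  /-- the Cartan involution whose fixed algebra is the Lie algebra of `K` -/
  θ : lieAlg G →ₗ⁅ℝ⁆ lieAlg G
  θ_θ : ∀ X, θ (θ X) = X
  killing_θ_neg : ∀ X, X ≠ 0 → killingForm ℝ (lieAlg G) X (θ X) < 0
  θ_fixed_iff : ∀ X : lieAlg G, θ X = X ↔ ∀ t : ℝ, ∃ k ∈ K,
    toMat k = NormedSpace.exp (t • (X : Matrix (Fin n) (Fin n) ℝ))
  /-- the maximal abelian subspace `𝔞` of `𝔭 = {X | θ X = -X}`, the Lie algebra of `A` -/
  𝔞 : Submodule ℝ (lieAlg G)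
  𝔞_le_𝔭 : ∀ X ∈ 𝔞, θ X = -X
  𝔞_abelian : ∀ X ∈ 𝔞, ∀ Y ∈ 𝔞, ⁅X, Y⁆ = 0
  𝔞_maximal : ∀ 𝔟 : Submodule ℝ (lieAlg G), (∀ X ∈ 𝔟, θ X = -X) →
    (∀ X ∈ 𝔟, ∀ Y ∈ 𝔟, ⁅X, Y⁆ = 0) → 𝔞 ≤ 𝔟 → 𝔟 = 𝔞
  /-- a regular element, singling out the positive Weyl chamber -/
  H₀ : 𝔞
  H₀_regular : ∀ α : Module.Dual ℝ 𝔞, IsRoot 𝔞 α → α H₀ ≠ 0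
  /-- an element of `K` which normalizes `𝔞` and maps `𝔞⁺` to `-𝔞⁺` -/
  w₀ : G
  w₀_mem : w₀ ∈ K
  w₀_normalizes : ∀ v : 𝔞, ∃ u : 𝔞,
    toMat w₀ * ((v : lieAlg G) : Matrix (Fin n) (Fin n) ℝ) * toMat w₀⁻¹ = ((u : lieAlg G) : _)
  w₀_chamber : ∀ v u : 𝔞,
    toMat w₀ * ((v : lieAlg G) : Matrix (Fin n) (Fin n) ℝ) * toMat w₀⁻¹ = ((u : lieAlg G) : _) →
      (v ∈ weylChamber 𝔞 H₀ ↔ -u ∈ weylChamber 𝔞 H₀)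

namespace CartanData

variable {G : Subgroup (GL (Fin n) ℝ)} (D : CartanData G)

instance : MeasurableSpace D.𝔞 := borel D.𝔞

instance : BorelSpace D.𝔞 := ⟨rfl⟩

/-- `A = exp 𝔞`. -/
def A : Subgroup G :=
  Subgroup.closure {g | ∃ X ∈ D.𝔞, toMat g = NormedSpace.exp (X : Matrix (Fin n) (Fin n) ℝ)}

/-- The sum `𝔫` of the positive root spaces. -/
def 𝔫 : Submodule ℝ (lieAlg G) :=
  ⨆ α ∈ {α : Module.Dual ℝ D.𝔞 | IsRoot D.𝔞 α ∧ 0 < α D.H₀}, rootSpace D.𝔞 α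

/-- `N = exp 𝔫`. -/
def N : Subgroup G :=
  Subgroup.closure {g | ∃ X ∈ D.𝔫, toMat g = NormedSpace.exp (X : Matrix (Fin n) (Fin n) ℝ)}

/-- `M`, the centralizer of `𝔞` (equivalently, of `A`) in `K`. -/
def M : Subgroup G where
  carrier := {k | k ∈ D.K ∧ ∀ X ∈ D.𝔞,
    toMat k * (X : Matrix (Fin n) (Fin n) ℝ) = (X : Matrix (Fin n) (Fin n) ℝ) * toMat k}
  mul_mem' := by
    rintro a b ⟨ha, ha'⟩ ⟨hb, hb'⟩
    refine ⟨D.K.mul_mem ha hb, fun X hX => ?_⟩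
    have e : toMat (a * b) = toMat a * toMat b := rfl
    rw [e, mul_assoc, hb' X hX, ← mul_assoc, ha' X hX, mul_assoc]
  one_mem' := by
    refine ⟨D.K.one_mem, fun X _ => ?_⟩
    have e : toMat (1 : G) = 1 := rfl
    rw [e, one_mul, mul_one]
  inv_mem' := by
    rintro a ⟨ha, ha'⟩
    refine ⟨D.K.inv_mem ha, fun X hX => ?_⟩
    have e1 : toMat a⁻¹ * toMat a = 1 := by
      change toMat (a⁻¹ * a) = 1
      rw [inv_mul_cancel]
      rfl
    have e2 : toMat a * toMat a⁻¹ = 1 := by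
      change toMat (a * a⁻¹) = 1
      rw [mul_inv_cancel]
      rfl
    calc toMat a⁻¹ * (X : Matrix (Fin n) (Fin n) ℝ)
        = toMat a⁻¹ * ((X : Matrix (Fin n) (Fin n) ℝ) * toMat a) * toMat a⁻¹ := by
          rw [mul_assoc, mul_assoc, e2, mul_one]
      _ = (X : Matrix (Fin n) (Fin n) ℝ) * toMat a⁻¹ := by
          rw [← ha' X hX, ← mul_assoc, e1, one_mul]

/-- The minimal parabolic subgroup `P = MAN`. -/
def P : Subgroup G := D.M ⊔ D.A ⊔ D.N

lemma continuous_toMat : Continuous (toMat : G → Matrix (Fin n) (Fin n) ℝ) :=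
  Units.continuous_val.comp continuous_subtype_val

instance : CompactSpace D.M := by
  refine isCompact_iff_compactSpace.mp (?_ : IsCompact (D.M : Set G))
  have h : IsClosed {k : G | ∀ X ∈ D.𝔞,
      toMat k * (X : Matrix (Fin n) (Fin n) ℝ) = (X : Matrix (Fin n) (Fin n) ℝ) * toMat k} := by
    simp only [Set.ofPred_forall]
    refine isClosed_iInter fun X => isClosed_iInter fun _ => isClosed_eq ?_ ?_
    · exact continuous_toMat.mul continuous_const
    · exact continuous_const.mul continuous_toMat
  exact D.isCompact_K.inter_right h

/-- The Iwasawa cocycle: `H g` is the element of `𝔞` with `g ∈ K exp (H g) N`. -/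
def H (g : G) : D.𝔞 :=
  open Classical in
  if h : ∃ v : D.𝔞, ∃ k ∈ D.K, ∃ a : G, ∃ u ∈ D.N,
      toMat a = NormedSpace.exp ((v : lieAlg G) : Matrix (Fin n) (Fin n) ℝ) ∧ g = k * a * u
  then h.choose else 0

/-! ### The symmetric space, the Furstenberg boundary and the space `G/M` -/

/-- The Riemannian symmetric space `X = G/K`. -/
def X : Type := G ⧸ D.K

/-- The Furstenberg boundary `𝓕 = G/P`. -/
def F : Type := G ⧸ D.P

/-- The homogeneous space `G/M`. -/
def GM : Type := G ⧸ D.M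

instance : TopologicalSpace D.X := inferInstanceAs (TopologicalSpace (G ⧸ D.K))
instance : MulAction G D.X := inferInstanceAs (MulAction G (G ⧸ D.K))
instance : MeasurableSpace D.X := borel D.X
instance : BorelSpace D.X := ⟨rfl⟩

instance : TopologicalSpace D.F := inferInstanceAs (TopologicalSpace (G ⧸ D.P))
instance : MulAction G D.F := inferInstanceAs (MulAction G (G ⧸ D.P))
instance : ContinuousConstSMul G D.F := inferInstanceAs (ContinuousConstSMul G (G ⧸ D.P))
instance : MeasurableSpace D.F := borel D.F
instance : BorelSpace D.F := ⟨rfl⟩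

instance : TopologicalSpace D.GM := inferInstanceAs (TopologicalSpace (G ⧸ D.M))
instance : MeasurableSpace D.GM := borel D.GM
instance : BorelSpace D.GM := ⟨rfl⟩

/-- The orbit map `g ↦ g o`, where `o = [K]`. -/
def toX (g : G) : D.X := (QuotientGroup.mk g : G ⧸ D.K)

/-- The base point `o = [K]`. -/
def o : D.X := D.toX 1

/-- The visual map `g ↦ g⁺ = gP`. -/
def plus (g : G) : D.F := (QuotientGroup.mk g : G ⧸ D.P)

/-- The visual map `g ↦ g⁻ = g w₀ P`. -/
def minus (g : G) : D.F := (QuotientGroup.mk (g * D.w₀) : G ⧸ D.P)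

/-- A representative in `G` of a point of `X`. -/
def repX (x : D.X) : G := Quotient.out (s := QuotientGroup.leftRel D.K) x

/-- A representative in `G` of a point of `𝓕`. -/
def repF (ξ : D.F) : G := Quotient.out (s := QuotientGroup.leftRel D.P) ξ

/-- A representative in `G` of a point of `G/M`. -/
def repGM (q : D.GM) : G := Quotient.out (s := QuotientGroup.leftRel D.M) q

/-- The `𝔞`-valued Busemann map: `β_{hP}(g o, g' o) = H(g⁻¹h) - H(g'⁻¹h)`. The right-hand side does
not depend on the representatives, and for `h ∈ K` it is the usual formula. -/
def busemann (ξ : D.F) (x y : D.X) : D.𝔞 :=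
  D.H ((D.repX x)⁻¹ * D.repF ξ) - D.H ((D.repX y)⁻¹ * D.repF ξ)

/-! ### The Riemannian distance on `X` -/

/-- The norm, with respect to the Killing form, of the `𝔭`-component of `Z ∈ 𝔤 = 𝔨 ⊕ 𝔭`. For
`g ∈ G` this is the Riemannian norm of the tangent vector to `t ↦ g exp(tZ) o` at `t = 0`. -/
def pNorm (Z : lieAlg G) : ℝ :=
  Real.sqrt (killingForm ℝ (lieAlg G) ((1 / 2 : ℝ) • (Z - D.θ Z)) ((1 / 2 : ℝ) • (Z - D.θ Z)))

/-- `L` is the length of a `C¹` curve in `X` from `x` to `y`. The curve is `t ↦ c(t) o`,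
`0 ≤ t ≤ 1`, for a `C¹` curve `c` in `G` with continuous logarithmic derivative `u = c⁻¹ c'`. -/
def IsCurveLength (x y : D.X) (L : ℝ) : Prop :=
  ∃ (c : ℝ → G) (u : ℝ → lieAlg G), Continuous u ∧
    (∀ (t : ℝ) (i j : Fin n), HasDerivAt (fun s => toMat (c s) i j)
      ((toMat (c t) * (u t : Matrix (Fin n) (Fin n) ℝ)) i j) t) ∧
    D.toX (c 0) = x ∧ D.toX (c 1) = y ∧ L = ∫ t in (0 : ℝ)..1, D.pNorm (u t)

/-- The Riemannian distance on `X`, for the metric induced by the Killing form. -/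
def dist (x y : D.X) : ℝ := sInf {L | D.IsCurveLength x y L}

end CartanData

/-! ### Quotients by `Γ` and induced measures -/

/-- The quotient `Γ\Y`, with the quotient topology and its Borel `σ`-algebra. -/
def LeftQuot (Γ : Type*) [Group Γ] (Y : Type*) [MulAction Γ Y] : Type _ :=
  MulAction.orbitRel.Quotient Γ Y

section LeftQuot

variable (Γ : Type*) [Group Γ] {Y : Type*} [MulAction Γ Y] [TopologicalSpace Y]

instance : TopologicalSpace (LeftQuot Γ Y) :=
  inferInstanceAs (TopologicalSpace (Quotient (MulAction.orbitRel Γ Y)))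
instance : MeasurableSpace (LeftQuot Γ Y) := borel _
instance : BorelSpace (LeftQuot Γ Y) := ⟨rfl⟩

/-- The projection `Y → Γ\Y`. -/
def LeftQuot.mk (y : Y) : LeftQuot Γ Y := Quotient.mk (MulAction.orbitRel Γ Y) y

/-- The measure on `Γ\Y` induced by a `Γ`-invariant measure `μ` on `Y`: the least measure for which
the projection does not decrease the measure of the Borel sets on which it is injective. If `B` is
a Borel fundamental domain, this is the image of the restriction of `μ` to `B`. -/
def inducedMeasure [MeasurableSpace Y] (μ : Measure Y) : Measure (LeftQuot Γ Y) :=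
  ⨆ B : {B : Set Y // MeasurableSet B ∧ Set.InjOn (LeftQuot.mk Γ) B},
    (μ.restrict B.1).map (LeftQuot.mk Γ)

end LeftQuot

/-! ### Conformal densities and Bowen-Margulis-Sullivan measures -/

variable {G : Subgroup (GL (Fin n) ℝ)}

/-- A `(Γ, ψ)`-conformal density on `𝓕`. -/
structure ConformalDensity (D : CartanData G) (Γ : Subgroup G) (ψ : Module.Dual ℝ D.𝔞) where
  meas : D.X → Measure D.F
  finite : ∀ x, IsFiniteMeasure (meas x)
  density : ∀ x y, meas x =
    (meas y).withDensity fun ξ => ENNReal.ofReal (Real.exp (-ψ (D.busemann ξ x y)))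
  equivariant : ∀ (γ : Γ) (x : D.X), (meas x).map (fun ξ => (γ : G) • ξ) = meas ((γ : G) • x)

variable {D : CartanData G} {Γ : Subgroup G} {ψ ψ₁ ψ₂ : Module.Dual ℝ D.𝔞}

/-- The function `E_ν([x]) = |ν_x|` on `Γ\X`. -/
def ConformalDensity.E (ν : ConformalDensity D Γ ψ) : LeftQuot Γ D.X → ℝ≥0∞ :=
  Quotient.lift (s := MulAction.orbitRel Γ D.X) (fun x => ν.meas x Set.univ) (by
    intro x y h
    obtain ⟨γ, rfl⟩ := MulAction.orbitRel_apply.mp h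
    change ν.meas ((γ : G) • y) Set.univ = _
    rw [← ν.equivariant γ y, Measure.map_apply (continuous_const_smul (γ : G)).measurable
      MeasurableSet.univ, Set.preimage_univ])

/-- The Hopf parametrization `gM ↦ (g⁺, g⁻, β_{g⁻}(o, g o))`, which identifies `G/M` with
`𝓕⁽²⁾ × 𝔞 ⊆ 𝓕 × 𝓕 × 𝔞`. -/
def hopf (D : CartanData G) (q : D.GM) : D.F × D.F × D.𝔞 :=
  (D.plus (D.repGM q), D.minus (D.repGM q),
    D.busemann (D.minus (D.repGM q)) D.o (D.toX (D.repGM q)))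

/-- The measure on `G/M` given in Hopf coordinates by
`exp (ψ₁ (β_{g⁺}(o, g o)) + ψ₂ (β_{g⁻}(o, g o))) dν_o(g⁺) dν̄_o(g⁻) dv`, where `dv` is the Lebesgue
measure `ℓ` on `𝔞`. -/
def bmsGM (ℓ : Measure D.𝔞) (ν : ConformalDensity D Γ ψ₁) (ν' : ConformalDensity D Γ ψ₂) :
    Measure D.GM :=
  (((ν.meas D.o).prod ((ν'.meas D.o).prod ℓ)).comap (hopf D)).withDensity fun q =>
    ENNReal.ofReal (Real.exp
      (ψ₁ (D.busemann (D.plus (D.repGM q)) D.o (D.toX (D.repGM q))) +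
        ψ₂ (D.busemann (D.minus (D.repGM q)) D.o (D.toX (D.repGM q)))))

/-- Its right `M`-invariant lift to `G`: integrate over the fibres `gM` with respect to the Haar
probability measure of `M`. -/
def bmsG (ℓ : Measure D.𝔞) (ν : ConformalDensity D Γ ψ₁) (ν' : ConformalDensity D Γ ψ₂) :
    Measure G :=
  (bmsGM ℓ ν ν').bind fun q =>
    (Measure.haarMeasure (⊤ : TopologicalSpace.PositiveCompacts D.M)).map
      fun m : D.M => D.repGM q * (m : G)

/-- The generalized Bowen-Margulis-Sullivan measure `m_{ν,ν̄}` on `Γ\G`. -/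
def bms (ℓ : Measure D.𝔞) (ν : ConformalDensity D Γ ψ₁) (ν' : ConformalDensity D Γ ψ₂) :
    Measure (LeftQuot Γ G) :=
  inducedMeasure Γ (bmsG ℓ ν ν')

/-- The points of `Γ\X` at distance less than one from (the image in `Γ\X` of) `S ⊆ Γ\G`. -/
def oneNeighborhood (D : CartanData G) (Γ : Subgroup G) (S : Set (LeftQuot Γ G)) :
    Set (LeftQuot Γ D.X) :=
  {p | ∃ (x : D.X) (g : G), LeftQuot.mk Γ x = p ∧ LeftQuot.mk Γ g ∈ S ∧ D.dist x (D.toX g) < 1}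

end Smearing

end

/-!
Smearing. Let `F ⊆ X` be a Borel set meeting every `Γ`-orbit exactly once and let `V` be a small
ball around `o`. Unfolding over `Γ` turns `vol(V) m(Γ\G)` into the integral over `x ∈ F` of the
`m̃`-measure of the set of `g` whose base point `g o` lies near `x`. Such a `g` determines a flat
through a point near `x`, so both Busemann values `β_{g^±}(x, g o)` stay in a fixed compact set
`L ⊆ 𝔞`. In Hopf coordinates the flat therefore contributes at most `ℓ(L)`, and the density of `m̃`
is comparable to that of `ν_x ⊗ ν̄_x ⊗ dv`; hence the inner measure is at most a constant times
`|ν_x| |ν̄_x|`, and it vanishes unless `x` is within distance one of the support.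
-/

noncomputable section

namespace Smearing

open Filter

variable {n : ℕ} {G : Subgroup (GL (Fin n) ℝ)}

section Exponential

variable {𝔸 : Type*} [NormedRing 𝔸] [NormedAlgebra ℝ 𝔸] [CompleteSpace 𝔸]

lemma tendsto_natFloor_div_mul {ι : Type*} {l : Filter ι} {t : ι → ℝ}
    (ht : Tendsto t l (𝓝[>] 0)) {s : ℝ} (hs : 0 ≤ s) :
    Tendsto (fun i => (⌊s / t i⌋₊ : ℝ) * t i) l (𝓝 s) := by
  simpa [Function.comp_def, div_eq_mul_inv] using
    (tendsto_nat_floor_mul_div_atTop hs).comp (tendsto_inv_nhdsGT_zero.comp ht)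

lemma exists_exp_eq_of_tendsto_smul_sub_one {ι : Type*} {l : Filter ι} {x : ι → 𝔸} {t : ι → ℝ}
    {X : 𝔸} (ht : Tendsto t l (𝓝[>] 0)) (hx : Tendsto (fun i => (t i)⁻¹ • (x i - 1)) l (𝓝 X)) :
    ∃ y : ι → 𝔸, (∀ᶠ i in l, NormedSpace.exp (y i) = x i) ∧
      Tendsto (fun i => (t i)⁻¹ • y i) l (𝓝 X) := by
  have hexp : HasStrictFDerivAt (NormedSpace.exp : 𝔸 → 𝔸)
      ((ContinuousLinearEquiv.refl ℝ 𝔸 : 𝔸 ≃L[ℝ] 𝔸) : 𝔸 →L[ℝ] 𝔸) 0 := hasStrictFDerivAt_exp_zero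
  set log := hexp.localInverse
  have hlog_one : log 1 = 0 := by simpa [log] using hexp.localInverse_apply_image
  have hlog : HasFDerivAt log (ContinuousLinearMap.id ℝ 𝔸) 1 := by
    simpa using hexp.to_localInverse.hasFDerivAt
  have hexp_log : ∀ᶠ z in 𝓝 (1 : 𝔸), NormedSpace.exp (log z) = z := by
    simpa using hexp.eventually_right_inverse
  have hsub : Tendsto (fun i => x i - 1) l (𝓝 0) := by
    have h := (tendsto_nhds_of_tendsto_nhdsWithin ht).smul hx
    rw [zero_smul] at h
    refine h.congr' ?_
    filter_upwards [ht self_mem_nhdsWithin] with i hi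
    exact smul_inv_smul₀ (ne_of_gt hi) _
  refine ⟨fun i => log (x i), ?_, ?_⟩
  · exact Tendsto.eventually (by simpa using hsub.add_const 1) hexp_log
  · simpa [hlog_one] using
      hlog.hasFDerivWithinAt.lim hsub (Eventually.of_forall fun _ => Set.mem_univ _) hx

lemma tendsto_pow_natFloor_exp {ι : Type*} {l : Filter ι} {x : ι → 𝔸} {t : ι → ℝ} {X : 𝔸}
    (ht : Tendsto t l (𝓝[>] 0)) (hx : Tendsto (fun i => (t i)⁻¹ • (x i - 1)) l (𝓝 X))
    {s : ℝ} (hs : 0 ≤ s) :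
    Tendsto (fun i => x i ^ ⌊s / t i⌋₊) l (𝓝 (NormedSpace.exp (s • X))) := by
  obtain ⟨y, hyx, hy⟩ := exists_exp_eq_of_tendsto_smul_sub_one ht hx
  let _ := NormedAlgebra.restrictScalars ℚ ℝ 𝔸
  refine (((NormedSpace.exp_continuous (𝔸 := 𝔸)).tendsto _).comp
    ((tendsto_natFloor_div_mul ht hs).smul hy)).congr' ?_
  filter_upwards [hyx, ht self_mem_nhdsWithin] with i hi hti
  rw [Function.comp_apply, smul_smul, mul_assoc, mul_inv_cancel₀ (ne_of_gt hti), mul_one,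
    Nat.cast_smul_eq_nsmul, NormedSpace.exp_nsmul, hi]

lemma hasDerivAt_exp_smul_zero (X : 𝔸) :
    HasDerivAt (fun t : ℝ => NormedSpace.exp (t • X)) X 0 := by
  simpa using hasDerivAt_exp_smul_const (𝕂 := ℝ) X (0 : ℝ)

end Exponential

lemma toMat_mul (g h : G) : toMat (g * h) = toMat g * toMat h := rfl

lemma toMat_one : toMat (1 : G) = 1 := rfl

lemma toMat_mul_inv (g : G) : toMat g * toMat g⁻¹ = 1 := by
  rw [← toMat_mul, mul_inv_cancel, toMat_one]

lemma toMat_inv_mul (g : G) : toMat g⁻¹ * toMat g = 1 := by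
  rw [← toMat_mul, inv_mul_cancel, toMat_one]

lemma toMat_pow (g : G) (k : ℕ) : toMat (g ^ k) = toMat g ^ k := rfl

lemma toMat_inv_of_eq_exp {g : G} {X : Matrix (Fin n) (Fin n) ℝ}
    (h : toMat g = NormedSpace.exp X) : toMat g⁻¹ = NormedSpace.exp (-X) := by
  rw [Matrix.exp_neg, ← h]
  exact (Matrix.inv_eq_left_inv (toMat_inv_mul g)).symm

section ClosedSubgroup

open scoped Matrix.Norms.Operator

lemma isOpenEmbedding_val_GL :
    IsOpenEmbedding (Units.val : GL (Fin n) ℝ → Matrix (Fin n) (Fin n) ℝ) :=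
  Units.isOpenEmbedding_val

lemma isEmbedding_toMat : IsEmbedding (toMat : G → Matrix (Fin n) (Fin n) ℝ) :=
  isOpenEmbedding_val_GL.isEmbedding.comp .subtypeVal

lemma toMat_injective : Function.Injective (toMat : G → Matrix (Fin n) (Fin n) ℝ) :=
  isEmbedding_toMat.injective

variable [hG : Fact (IsClosed (G : Set (GL (Fin n) ℝ)))]

lemma mem_range_toMat_of_tendsto {ι : Type*} {l : Filter ι} [l.NeBot]
    {x : ι → Matrix (Fin n) (Fin n) ℝ} {y : Matrix (Fin n) (Fin n) ℝ} (hy : IsUnit y)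
    (hx : ∀ i, x i ∈ Set.range (toMat : G → _)) (h : Tendsto x l (𝓝 y)) :
    y ∈ Set.range (toMat : G → _) := by
  choose g hg using hx
  obtain ⟨u, rfl⟩ := hy
  have hgu : Tendsto (fun i => (g i : GL (Fin n) ℝ)) l (𝓝 u) :=
    isOpenEmbedding_val_GL.isEmbedding.tendsto_nhds_iff.2 (h.congr fun i => (hg i).symm)
  exact ⟨⟨u, hG.out.mem_of_tendsto hgu (Eventually.of_forall fun i => (g i).2)⟩, rfl⟩

variable (G) in
/-- The matrices which generate a one-parameter subgroup of `G`. It is shown in `mem_lieAlg_iff`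
that they form the Lie algebra when `G` is closed. -/
def oneParamSet : Set (Matrix (Fin n) (Fin n) ℝ) :=
  {X | ∀ t : ℝ, NormedSpace.exp (t • X) ∈ Set.range (toMat : G → _)}

lemma mem_oneParamSet_of_tendsto {ι : Type*} {l : Filter ι} [l.NeBot]
    {x : ι → Matrix (Fin n) (Fin n) ℝ} {t : ι → ℝ} {X : Matrix (Fin n) (Fin n) ℝ}
    (hxG : ∀ i, x i ∈ Set.range (toMat : G → _)) (ht : Tendsto t l (𝓝[>] 0))
    (hx : Tendsto (fun i => (t i)⁻¹ • (x i - 1)) l (𝓝 X)) : X ∈ oneParamSet G := by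
  have of_nonneg (s : ℝ) (hs : 0 ≤ s) :
      NormedSpace.exp (s • X) ∈ Set.range (toMat : G → _) := by
    refine mem_range_toMat_of_tendsto (Matrix.isUnit_exp _) (fun i => ?_)
      (tendsto_pow_natFloor_exp ht hx hs)
    obtain ⟨g, hg⟩ := hxG i
    exact ⟨g ^ ⌊s / t i⌋₊, by rw [toMat_pow, hg]⟩
  intro s
  rcases le_total 0 s with hs | hs
  · exact of_nonneg s hs
  · obtain ⟨g, hg⟩ := of_nonneg (-s) (neg_nonneg.2 hs)
    exact ⟨g⁻¹, by rw [toMat_inv_of_eq_exp hg, neg_smul, neg_neg]⟩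

lemma mem_oneParamSet_of_hasDerivAt {c : ℝ → Matrix (Fin n) (Fin n) ℝ}
    {X : Matrix (Fin n) (Fin n) ℝ} (hcG : ∀ t, c t ∈ Set.range (toMat : G → _)) (hc0 : c 0 = 1)
    (hc : HasDerivAt c X 0) : X ∈ oneParamSet G := by
  refine mem_oneParamSet_of_tendsto (l := 𝓝[>] 0) hcG tendsto_id ?_
  have hslope := (hasDerivAt_iff_tendsto_slope_zero.1 hc).mono_left (nhdsGT_le_nhdsNE 0)
  simp only [zero_add, hc0] at hslope
  exact hslope

omit hG in
lemma conj_mem_oneParamSet (g : G) {X : Matrix (Fin n) (Fin n) ℝ} (hX : X ∈ oneParamSet G) :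
    toMat g * X * toMat g⁻¹ ∈ oneParamSet G := by
  intro t
  obtain ⟨h, hh⟩ := hX t
  refine ⟨g * h * g⁻¹, ?_⟩
  rw [toMat_mul, toMat_mul, hh, ← smul_mul_assoc, ← mul_smul_comm]
  exact (Matrix.exp_units_conj (g : GL (Fin n) ℝ) (t • X)).symm

variable (G) in
/-- `oneParamSet G` as a linear subspace, for closed `G`. -/
def oneParamSubmodule : Submodule ℝ (Matrix (Fin n) (Fin n) ℝ) where
  carrier := oneParamSet G
  zero_mem' t := ⟨1, by simp [toMat_one]⟩
  add_mem' {X Y} hX hY := by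
    refine mem_oneParamSet_of_hasDerivAt
      (c := fun t => NormedSpace.exp (t • X) * NormedSpace.exp (t • Y)) (fun t => ?_) (by simp) ?_
    · obtain ⟨g, hg⟩ := hX t
      obtain ⟨h, hh⟩ := hY t
      exact ⟨g * h, by rw [toMat_mul, hg, hh]⟩
    · have hderiv := (hasDerivAt_exp_smul_zero X).fun_mul (hasDerivAt_exp_smul_zero Y)
      simp only [zero_smul, NormedSpace.exp_zero, mul_one, one_mul] at hderiv
      exact hderiv
  smul_mem' c X hX t := by
    rw [smul_smul]
    exact hX _

lemma lie_mem_oneParamSubmodule {X Y : Matrix (Fin n) (Fin n) ℝ} (hX : X ∈ oneParamSubmodule G)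
    (hY : Y ∈ oneParamSubmodule G) : ⁅X, Y⁆ ∈ oneParamSubmodule G := by
  have hderiv : HasDerivAt (fun t : ℝ => NormedSpace.exp (t • X) * Y * NormedSpace.exp (t • -X))
      ⁅X, Y⁆ 0 := by
    have h := ((hasDerivAt_exp_smul_zero X).mul_const Y).fun_mul (hasDerivAt_exp_smul_zero (-X))
    simp only [zero_smul, NormedSpace.exp_zero, mul_one, one_mul, mul_neg, ← sub_eq_add_neg] at h
    exact h
  have hmem (t : ℝ) :
      NormedSpace.exp (t • X) * Y * NormedSpace.exp (t • -X) ∈ oneParamSubmodule G := by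
    obtain ⟨g, hg⟩ := hX t
    have h := conj_mem_oneParamSet g hY
    rwa [toMat_inv_of_eq_exp hg, hg, ← smul_neg] at h
  refine (Submodule.closed_of_finiteDimensional (oneParamSubmodule G)).mem_of_tendsto
    (hasDerivAt_iff_tendsto_slope_zero.1 hderiv) (Eventually.of_forall fun t => ?_)
  exact Submodule.smul_mem _ _ (Submodule.sub_mem _ (hmem _) (hmem _))

lemma mem_lieAlg_iff {X : Matrix (Fin n) (Fin n) ℝ} : X ∈ lieAlg G ↔ X ∈ oneParamSet G := by
  have hgen : {X : Matrix (Fin n) (Fin n) ℝ | ∀ t : ℝ, ∃ g ∈ G,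
      (g : Matrix (Fin n) (Fin n) ℝ) = NormedSpace.exp (t • X)} = oneParamSet G := by
    simp [oneParamSet, toMat]
  let T : LieSubalgebra ℝ (Matrix (Fin n) (Fin n) ℝ) :=
    { oneParamSubmodule G with lie_mem' := lie_mem_oneParamSubmodule }
  rw [lieAlg, hgen]
  exact ⟨fun h => (LieSubalgebra.lieSpan_le.2 fun _ hX => hX : _ ≤ T) h,
    fun h => LieSubalgebra.subset_lieSpan h⟩

lemma mem_lieAlg_of_tendsto_exp {ι : Type*} {l : Filter ι} [l.NeBot]
    {w : ι → Matrix (Fin n) (Fin n) ℝ} {W : Matrix (Fin n) (Fin n) ℝ}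
    (hwG : ∀ i, NormedSpace.exp (w i) ∈ Set.range (toMat : G → _)) (hw : Tendsto w l (𝓝[≠] 0))
    (hW : Tendsto (fun i => ‖w i‖⁻¹ • w i) l (𝓝 W)) : W ∈ lieAlg G := by
  have hexp : HasFDerivAt (NormedSpace.exp : Matrix (Fin n) (Fin n) ℝ → _)
      (ContinuousLinearMap.id ℝ (Matrix (Fin n) (Fin n) ℝ)) 0 := hasFDerivAt_exp_zero
  refine mem_lieAlg_iff.2 (mem_oneParamSet_of_tendsto hwG (tendsto_norm_nhdsNE_zero.comp hw) ?_)
  simpa using hexp.hasFDerivWithinAt.lim (tendsto_nhds_of_tendsto_nhdsWithin hw)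
    (Eventually.of_forall fun _ => Set.mem_univ _) hW

lemma eventually_exp_mem_range_imp_eq_zero {C : Submodule ℝ (Matrix (Fin n) (Fin n) ℝ)}
    (hC : Disjoint (lieAlg G).toSubmodule C) :
    ∀ᶠ w : C in 𝓝 0, NormedSpace.exp (w : Matrix (Fin n) (Fin n) ℝ) ∈ Set.range (toMat : G → _) →
      w = 0 := by
  by_contra hcon
  simp only [not_eventually, Classical.not_imp] at hcon
  have : (𝓝 (0 : C)).IsCountablyGenerated :=
    (Metric.nhds_basis_ball_inv_nat_succ (x := (0 : C))).isCountablyGenerated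
  obtain ⟨w, hw, hwG⟩ := exists_seq_forall_of_frequently hcon
  have hsphere (i : ℕ) : ‖w i‖⁻¹ • w i ∈ Metric.sphere (0 : C) 1 := by
    rw [mem_sphere_zero_iff_norm, norm_smul, norm_inv, norm_norm,
      inv_mul_cancel₀ (norm_ne_zero_iff.2 (hwG i).2)]
  obtain ⟨W, hW, φ, hφ, hlim⟩ := (isCompact_sphere (0 : C) 1).tendsto_subseq hsphere
  have hwφ : Tendsto (fun i => (w (φ i) : Matrix (Fin n) (Fin n) ℝ)) atTop (𝓝[≠] 0) :=
    tendsto_nhdsWithin_iff.2 ⟨(continuous_subtype_val.tendsto (0 : C)).comp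
      (hw.comp hφ.tendsto_atTop), Eventually.of_forall fun i => by simpa using (hwG (φ i)).2⟩
  have hmem : (W : Matrix (Fin n) (Fin n) ℝ) ∈ lieAlg G :=
    mem_lieAlg_of_tendsto_exp (fun i => (hwG (φ i)).1) hwφ
      ((continuous_subtype_val.tendsto W).comp hlim)
  have hW0 : W = 0 := Subtype.ext (Submodule.disjoint_def.1 hC _ hmem W.2)
  simp [hW0] at hW

omit hG in
lemma map_nhds_zero_toMat_mul_exp {E : Type*} [NormedAddCommGroup E] [NormedSpace ℝ E]
    [CompleteSpace E] {f : E → G} (hf0 : f 0 = 1) {f' : E →L[ℝ] Matrix (Fin n) (Fin n) ℝ}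
    (hf : HasStrictFDerivAt (fun e => toMat (f e)) f' 0)
    {C : Submodule ℝ (Matrix (Fin n) (Fin n) ℝ)} (hC : f'.range ⊔ C = ⊤) :
    map (fun p : E × C => toMat (f p.1) * NormedSpace.exp (p.2 : Matrix (Fin n) (Fin n) ℝ)) (𝓝 0) =
      𝓝 1 := by
  have hfst : HasStrictFDerivAt (fun p : E × C => toMat (f p.1))
      (f'.comp (ContinuousLinearMap.fst ℝ E C)) (0 : E × C) :=
    HasStrictFDerivAt.comp (g := fun e => toMat (f e)) (f := Prod.fst) (0 : E × C) hf
      hasStrictFDerivAt_fst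
  have hsnd : HasStrictFDerivAt
      (fun p : E × C => NormedSpace.exp (p.2 : Matrix (Fin n) (Fin n) ℝ))
      (C.subtypeL.comp (ContinuousLinearMap.snd ℝ E C)) (0 : E × C) :=
    HasStrictFDerivAt.comp (g := (NormedSpace.exp : Matrix (Fin n) (Fin n) ℝ → _))
      (f := fun p : E × C => (p.2 : Matrix (Fin n) (Fin n) ℝ)) (0 : E × C)
      (hasStrictFDerivAt_exp_zero (𝕂 := ℝ))
      (C.subtypeL.comp (ContinuousLinearMap.snd ℝ E C)).hasStrictFDerivAt
  have hmap := (hfst.mul' hsnd).map_nhds_eq_of_surj (LinearMap.range_eq_top.2 fun Y => by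
    obtain ⟨_, ⟨e, rfl⟩, W, hW, rfl⟩ := Submodule.mem_sup.1 (hC ▸ Submodule.mem_top : Y ∈ _)
    refine ⟨(e, ⟨W, hW⟩), ?_⟩
    simp only [Prod.fst_zero, hf0, toMat_one, Prod.snd_zero, ZeroMemClass.coe_zero,
      NormedSpace.exp_zero, MulOpposite.op_one]
    change (1 : Matrix (Fin n) (Fin n) ℝ) * W + f' e * 1 = f' e + W
    rw [one_mul, mul_one, add_comm])
  exact hmap.trans (congrArg 𝓝 (by simp [hf0, toMat_one]))

lemma image_mem_nhds_one {E : Type*} [NormedAddCommGroup E] [NormedSpace ℝ E] [CompleteSpace E]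
    {f : E → G} (hf0 : f 0 = 1) {f' : E →L[ℝ] Matrix (Fin n) (Fin n) ℝ}
    (hf : HasStrictFDerivAt (fun e => toMat (f e)) f' 0)
    (hf' : (lieAlg G).toSubmodule ≤ f'.range) {U : Set E} (hU : U ∈ 𝓝 0) :
    f '' U ∈ 𝓝 (1 : G) := by
  obtain ⟨C, hC⟩ := Submodule.exists_isCompl (lieAlg G).toSubmodule
  have hUC : U ×ˢ {w : C | NormedSpace.exp (w : Matrix (Fin n) (Fin n) ℝ) ∈
      Set.range (toMat : G → _) → w = 0} ∈ 𝓝 (0 : E × C) :=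
    prod_mem_nhds hU (eventually_exp_mem_range_imp_eq_zero hC.disjoint)
  have himage := (map_nhds_zero_toMat_mul_exp hf0 hf
    (top_unique (hC.sup_eq_top ▸ sup_le_sup_right hf' C))).ge (image_mem_map hUC)
  refine mem_of_superset (CartanData.continuous_toMat.continuousAt (x := (1 : G)) himage) ?_
  rintro g ⟨⟨e, w⟩, ⟨he, hw⟩, hg⟩
  replace hg : toMat (f e) * NormedSpace.exp (w : Matrix (Fin n) (Fin n) ℝ) = toMat g := hg
  have hw0 : w = 0 := hw ⟨(f e)⁻¹ * g, by
    rw [toMat_mul, ← hg, ← mul_assoc, toMat_inv_mul, one_mul]⟩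
  refine ⟨e, he, toMat_injective ?_⟩
  simpa [hw0] using hg

end ClosedSubgroup

lemma IsRealAlgebraic.isClosed {H : Subgroup (GL (Fin n) ℝ)} (h : IsRealAlgebraic H) :
    IsClosed (H : Set (GL (Fin n) ℝ)) := by
  obtain ⟨S, hS⟩ := h
  have hH : (H : Set (GL (Fin n) ℝ)) = ⋂ p ∈ S, {g : GL (Fin n) ℝ |
      MvPolynomial.eval (fun ij => (g : Matrix (Fin n) (Fin n) ℝ) ij.1 ij.2) p = 0} := by
    ext g
    simp [hS g]
  rw [hH]
  refine isClosed_biInter fun p _ => isClosed_eq ?_ continuous_const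
  refine (MvPolynomial.continuous_eval p).comp (continuous_pi fun ij => ?_)
  exact (Units.continuous_val (M := Matrix (Fin n) (Fin n) ℝ)).matrix_elem ij.1 ij.2

lemma isClosed_identityComponent {H : Subgroup (GL (Fin n) ℝ)}
    (hH : IsClosed (H : Set (GL (Fin n) ℝ))) :
    IsClosed (identityComponent H : Set (GL (Fin n) ℝ)) := by
  rw [identityComponent, Subgroup.coe_map]
  exact hH.isClosedEmbedding_subtypeVal.isClosedMap _ isClosed_connectedComponent

lemma connectedSpace_identityComponent (H : Subgroup (GL (Fin n) ℝ)) :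
    ConnectedSpace (identityComponent H) := by
  refine isConnected_iff_connectedSpace.1
    (?_ : IsConnected (identityComponent H : Set (GL (Fin n) ℝ)))
  rw [identityComponent, Subgroup.coe_map]
  exact isConnected_connectedComponent.image _ continuous_subtype_val.continuousOn

lemma IsConnectedSemisimpleAlgebraic.isClosed (hG : IsConnectedSemisimpleAlgebraic G) :
    IsClosed (G : Set (GL (Fin n) ℝ)) := by
  obtain ⟨⟨H, hH, rfl⟩, -⟩ := hG
  exact isClosed_identityComponent hH.isClosed

lemma IsConnectedSemisimpleAlgebraic.connectedSpace (hG : IsConnectedSemisimpleAlgebraic G) :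
    ConnectedSpace G := by
  obtain ⟨⟨H, -, rfl⟩, -⟩ := hG
  exact connectedSpace_identityComponent H

section ConjExp

open scoped Nat

variable {𝔸 : Type*} [NormedRing 𝔸] [NormedAlgebra ℝ 𝔸] [CompleteSpace 𝔸]

lemma hasSum_exp_apply {E : Type*} [NormedAddCommGroup E] [NormedSpace ℝ E] [CompleteSpace E]
    (T : E →L[ℝ] E) (x : E) :
    HasSum (fun k : ℕ => (k ! : ℝ)⁻¹ • (T ^ k) x) (NormedSpace.exp T x) := by
  simpa using (NormedSpace.exp_series_hasSum_exp' (𝕂 := ℝ) T).mapL (ContinuousLinearMap.apply ℝ E x)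

lemma exp_mulLeft_apply (Z W : 𝔸) :
    NormedSpace.exp (ContinuousLinearMap.mul ℝ 𝔸 Z) W = NormedSpace.exp Z * W := by
  have hpow (k : ℕ) : (ContinuousLinearMap.mul ℝ 𝔸 Z ^ k) W = Z ^ k * W := by
    induction k with
    | zero => simp
    | succ k ih => rw [pow_succ', mul_apply_eq_comp, ih, pow_succ', mul_assoc]; rfl
  refine (hasSum_exp_apply _ W).unique ?_
  simpa [hpow] using (NormedSpace.exp_series_hasSum_exp' (𝕂 := ℝ) Z).mul_right W

lemma exp_mulRight_apply (Z W : 𝔸) :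
    NormedSpace.exp ((ContinuousLinearMap.mul ℝ 𝔸).flip Z) W = W * NormedSpace.exp Z := by
  have hpow (k : ℕ) : ((ContinuousLinearMap.mul ℝ 𝔸).flip Z ^ k) W = W * Z ^ k := by
    induction k with
    | zero => simp
    | succ k ih => rw [pow_succ', mul_apply_eq_comp, ih, pow_succ, ← mul_assoc]; rfl
  refine (hasSum_exp_apply _ W).unique ?_
  simpa only [hpow, mul_smul_comm] using
    (NormedSpace.exp_series_hasSum_exp' (𝕂 := ℝ) Z).mul_left W

lemma hasSum_conj_exp (Z Y : 𝔸) :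
    HasSum (fun k : ℕ => (k ! : ℝ)⁻¹ • ((fun W => Z * W - W * Z)^[k] Y))
      (NormedSpace.exp Z * Y * NormedSpace.exp (-Z)) := by
  set left : 𝔸 →L[ℝ] 𝔸 := ContinuousLinearMap.mul ℝ 𝔸 Z with hleft
  set right : 𝔸 →L[ℝ] 𝔸 := (ContinuousLinearMap.mul ℝ 𝔸).flip (-Z) with hright
  have hcomm : Commute left right := by
    ext W
    simp [hleft, hright, mul_assoc]
  have hiter (k : ℕ) : (fun W => Z * W - W * Z)^[k] Y = ((left + right) ^ k) Y := by
    induction k with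
    | zero => simp
    | succ k ih =>
      rw [Function.iterate_succ_apply', ih, pow_succ', mul_apply_eq_comp]
      simp [hleft, hright, sub_eq_add_neg]
  have hsum := hasSum_exp_apply (left + right) Y
  let _ := NormedAlgebra.restrictScalars ℚ ℝ (𝔸 →L[ℝ] 𝔸)
  rw [NormedSpace.exp_add_of_commute hcomm, mul_apply_eq_comp, exp_mulRight_apply,
    exp_mulLeft_apply, ← mul_assoc] at hsum
  simpa only [hiter] using hsum

end ConjExp

section Adjoint

variable [Fact (IsClosed (G : Set (GL (Fin n) ℝ)))]

lemma conj_mem_lieAlg (g : G) {X : Matrix (Fin n) (Fin n) ℝ} (hX : X ∈ lieAlg G) :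
    toMat g * X * toMat g⁻¹ ∈ lieAlg G :=
  mem_lieAlg_iff.2 (conj_mem_oneParamSet g (mem_lieAlg_iff.1 hX))

/-- The adjoint action of a closed subgroup `G` of `GL_n(ℝ)` on its Lie algebra, by conjugation of
matrices. -/
def Ad (g : G) : lieAlg G ≃ₗ⁅ℝ⁆ lieAlg G where
  toFun X := ⟨toMat g * X * toMat g⁻¹, conj_mem_lieAlg g X.2⟩
  invFun X := ⟨toMat g⁻¹ * X * toMat g, by simpa using conj_mem_lieAlg g⁻¹ X.2⟩
  map_add' X Y := Subtype.ext (by simp [mul_add, add_mul])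
  map_smul' c X := Subtype.ext (by simp)
  map_lie' {X Y} := Subtype.ext <| by
    simp only [LieSubalgebra.coe_bracket, LieRing.of_associative_ring_bracket, mul_sub, sub_mul,
      mul_assoc]
    simp only [← mul_assoc (toMat g⁻¹) (toMat g), toMat_inv_mul, one_mul]
  left_inv X := Subtype.ext <| by
    simp only [mul_assoc, toMat_inv_mul, mul_one]
    rw [← mul_assoc, toMat_inv_mul, one_mul]
  right_inv X := Subtype.ext <| by
    simp only [mul_assoc, toMat_mul_inv, mul_one]
    rw [← mul_assoc, toMat_mul_inv, one_mul]

lemma coe_Ad (g : G) (X : lieAlg G) :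
    (Ad g X : Matrix (Fin n) (Fin n) ℝ) = toMat g * X * toMat g⁻¹ := rfl

lemma Ad_mul (g h : G) (X : lieAlg G) : Ad (g * h) X = Ad g (Ad h X) :=
  Subtype.ext (by simp only [coe_Ad, toMat_mul, mul_inv_rev, mul_assoc])

lemma continuous_Ad (X : lieAlg G) : Continuous fun g : G => Ad g X :=
  ((CartanData.continuous_toMat.mul continuous_const).mul
    (CartanData.continuous_toMat.comp continuous_inv)).subtype_mk _

/-- The exponential map of a closed subgroup `G` of `GL_n(ℝ)`. -/
def expG (X : lieAlg G) : G := (mem_lieAlg_iff.1 X.2 1).choose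

lemma toMat_expG (X : lieAlg G) :
    toMat (expG X) = NormedSpace.exp (X : Matrix (Fin n) (Fin n) ℝ) :=
  (mem_lieAlg_iff.1 X.2 1).choose_spec.trans (by rw [one_smul])

lemma eq_expG {g : G} {X : lieAlg G}
    (h : toMat g = NormedSpace.exp (X : Matrix (Fin n) (Fin n) ℝ)) : g = expG X :=
  toMat_injective (h.trans (toMat_expG X).symm)

lemma expG_zero : expG (0 : lieAlg G) = 1 := (eq_expG (by simp [toMat_one])).symm

lemma expG_add {X Y : lieAlg G} (h : ⁅X, Y⁆ = 0) : expG (X + Y) = expG X * expG Y := by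
  refine (eq_expG ?_).symm
  rw [toMat_mul, toMat_expG, toMat_expG]
  exact (Matrix.exp_add_of_commute _ _ (sub_eq_zero.1 (congrArg Subtype.val h))).symm

lemma expG_neg (X : lieAlg G) : expG (-X) = (expG X)⁻¹ :=
  (eq_expG (toMat_inv_of_eq_exp (toMat_expG X))).symm

lemma conj_expG (g : G) (X : lieAlg G) : g * expG X * g⁻¹ = expG (Ad g X) := by
  refine eq_expG ?_
  rw [toMat_mul, toMat_mul, toMat_expG, coe_Ad]
  exact (Matrix.exp_units_conj (g : GL (Fin n) ℝ) _).symm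

open scoped Matrix.Norms.Operator Nat in
lemma hasSum_Ad_expG (Z Y : lieAlg G) :
    HasSum (fun k : ℕ => (k ! : ℝ)⁻¹ •
      (((fun W : lieAlg G => ⁅Z, W⁆)^[k] Y : lieAlg G) : Matrix (Fin n) (Fin n) ℝ))
      (Ad (expG Z) Y : Matrix (Fin n) (Fin n) ℝ) := by
  have hiter (k : ℕ) : (((fun W : lieAlg G => ⁅Z, W⁆)^[k] Y : lieAlg G) :
      Matrix (Fin n) (Fin n) ℝ) =
        (fun W => (Z : Matrix (Fin n) (Fin n) ℝ) * W - W * Z)^[k] (Y : Matrix (Fin n) (Fin n) ℝ) :=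
    Function.Semiconj.iterate_right (f := Subtype.val) (fun _ => rfl) k Y
  rw [coe_Ad, toMat_expG, toMat_inv_of_eq_exp (toMat_expG Z)]
  simp only [hiter]
  exact hasSum_conj_exp (Z : Matrix (Fin n) (Fin n) ℝ) (Y : Matrix (Fin n) (Fin n) ℝ)

lemma Ad_expG_sub_mem {V W : Submodule ℝ (lieAlg G)} (hWV : W ≤ V) {Z : lieAlg G}
    (h : ∀ Y ∈ V, ⁅Z, Y⁆ ∈ W) {Y : lieAlg G} (hY : Y ∈ V) : Ad (expG Z) Y - Y ∈ W := by
  have hsum := (hasSum_nat_add_iff' 1).2 (hasSum_Ad_expG Z Y)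
  simp only [Finset.range_one, Finset.sum_singleton, Nat.factorial_zero, Nat.cast_one, inv_one,
    one_smul, Function.iterate_zero, id_eq] at hsum
  have hiter (k : ℕ) : (fun W : lieAlg G => ⁅Z, W⁆)^[k + 1] Y ∈ W := by
    induction k with
    | zero => exact h Y hY
    | succ k ih =>
      rw [Function.iterate_succ']
      exact h _ (hWV ih)
  have hmem : (Ad (expG Z) Y : Matrix (Fin n) (Fin n) ℝ) - Y ∈
      W.map (lieAlg G).toSubmodule.subtype :=
    (Submodule.closed_of_finiteDimensional _).mem_of_tendsto hsum (Eventually.of_forall fun _ =>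
      Submodule.sum_mem _ fun k _ => Submodule.smul_mem _ _ ⟨_, hiter k, rfl⟩)
  obtain ⟨w, hw, hwe⟩ := hmem
  rwa [← (Subtype.ext hwe : w = Ad (expG Z) Y - Y)]

lemma Ad_expG_of_lie_eq_smul {Z Y : lieAlg G} {c : ℝ} (h : ⁅Z, Y⁆ = c • Y) :
    Ad (expG Z) Y = Real.exp c • Y := by
  have hiter (k : ℕ) : (fun W : lieAlg G => ⁅Z, W⁆)^[k] Y = c ^ k • Y := by
    induction k with
    | zero => simp
    | succ k ih => rw [Function.iterate_succ_apply', ih, lie_smul, h, smul_smul, pow_succ]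
  refine Subtype.ext ((hasSum_Ad_expG Z Y).unique ?_)
  have hexp := (NormedSpace.exp_series_hasSum_exp' (𝕂 := ℝ) c).smul_const
    (Y : Matrix (Fin n) (Fin n) ℝ)
  rw [← Real.exp_eq_exp_ℝ] at hexp
  simpa [hiter, smul_smul] using hexp

end Adjoint

lemma iSup_iInf_eigenspace_eq_top {V ι : Type*} [AddCommGroup V] [Module ℝ V]
    [FiniteDimensional ℝ V] (B : V →ₗ[ℝ] V →ₗ[ℝ] ℝ) (hsymm : ∀ x y, B x y = B y x)
    (hpos : ∀ x, x ≠ 0 → 0 < B x x) (T : ι → Module.End ℝ V)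
    (hT : ∀ i x y, B (T i x) y = B x (T i y)) (hcomm : ∀ i j, Commute (T i) (T j)) :
    ⨆ χ : ι → ℝ, ⨅ i, Module.End.eigenspace (T i) (χ i) = ⊤ := by
  let core : InnerProductSpace.Core ℝ V :=
    { inner := fun x y => B x y
      conj_inner_symm := fun x y => by simp [hsymm x y]
      re_inner_nonneg := fun x => by
        by_cases hx : x = 0
        · simp [hx]
        · simpa using (hpos x hx).le
      add_left := fun x y z => by simp
      smul_left := fun x y r => by simp
      definite := fun x hx => by
        by_contra h
        exact (hpos x h).ne' hx }
  let _ : NormedAddCommGroup V := core.toNormedAddCommGroup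
  let _ : InnerProductSpace ℝ V := InnerProductSpace.ofCore core.toCore
  exact LinearMap.IsSymmetric.iSup_iInf_eq_top_of_commute (fun i x y => hT i x y)
    fun i j _ => hcomm i j

lemma iInf_eigenspace_ad_le_iSup_rootSpace {L : Type*} [LieRing L] [LieAlgebra ℝ L]
    (𝔞 : Submodule ℝ L) (χ : 𝔞 → ℝ) :
    ⨅ v : 𝔞, Module.End.eigenspace (LieAlgebra.ad ℝ L (v : L)) (χ v) ≤ ⨆ α, rootSpace 𝔞 α := by
  intro Y hY
  have hχ (v : 𝔞) : ⁅(v : L), Y⁆ = χ v • Y :=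
    Module.End.mem_eigenspace_iff.1 ((Submodule.mem_iInf _).1 hY v)
  by_cases hY0 : Y = 0
  · rw [hY0]
    exact zero_mem _
  let α : Module.Dual ℝ 𝔞 :=
    { toFun := χ
      map_add' := fun v w => smul_left_injective ℝ hY0 <| by
        simp only [add_smul, ← hχ, Submodule.coe_add, add_lie]
      map_smul' := fun c v => smul_left_injective ℝ hY0 <| by
        simp only [smul_eq_mul, mul_smul, ← hχ, Submodule.coe_smul, smul_lie, RingHom.id_apply] }
  exact Submodule.mem_iSup_of_mem α hχ

instance : IsTopologicalAddGroup (lieAlg G) :=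
  inferInstanceAs (IsTopologicalAddGroup (lieAlg G).toSubmodule)

instance : ContinuousSMul ℝ (lieAlg G) :=
  inferInstanceAs (ContinuousSMul ℝ (lieAlg G).toSubmodule)

namespace CartanData

variable (D : CartanData G)

/-- The Cartan involution as an automorphism of the Lie algebra. -/
def θEquiv : lieAlg G ≃ₗ⁅ℝ⁆ lieAlg G :=
  { D.θ with
    invFun := D.θ
    left_inv := D.θ_θ
    right_inv := D.θ_θ }

lemma killingForm_θ_θ (X Y : lieAlg G) :
    killingForm ℝ (lieAlg G) (D.θ X) (D.θ Y) = killingForm ℝ (lieAlg G) X Y :=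
  LieAlgebra.killingForm_of_equiv_apply D.θEquiv X Y

lemma iSup_rootSpace : ⨆ α : Module.Dual ℝ D.𝔞, rootSpace D.𝔞 α = ⊤ := by
  let B : lieAlg G →ₗ[ℝ] lieAlg G →ₗ[ℝ] ℝ :=
    -((killingForm ℝ (lieAlg G)).compl₂ (D.θ : lieAlg G →ₗ[ℝ] lieAlg G))
  have hB (X Y) : B X Y = -killingForm ℝ (lieAlg G) X (D.θ Y) := rfl
  refine top_unique ((iSup_iInf_eigenspace_eq_top B (fun X Y => ?_) (fun X hX => ?_)
    (fun v : D.𝔞 => LieAlgebra.ad ℝ (lieAlg G) (v : lieAlg G)) (fun v X Y => ?_)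
    fun v w => ?_).ge.trans (iSup_le (iInf_eigenspace_ad_le_iSup_rootSpace D.𝔞)))
  · rw [hB, hB, ← D.killingForm_θ_θ X, D.θ_θ, LieModule.traceForm_comm]
  · rw [hB]
    exact neg_pos.2 (D.killing_θ_neg X hX)
  · rw [hB, hB, LieAlgebra.ad_apply, LieAlgebra.ad_apply, killingForm,
      LieModule.traceForm_apply_lie_apply', LieHom.map_lie, D.𝔞_le_𝔭 _ v.2, neg_lie, map_neg]
  · refine sub_eq_zero.1 ?_
    rw [← LieRing.of_associative_ring_bracket, ← LieHom.map_lie, D.𝔞_abelian _ v.2 _ w.2, map_zero]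

lemma θ_mem_rootSpace {α : Module.Dual ℝ D.𝔞} {X : lieAlg G} (hX : X ∈ rootSpace D.𝔞 α) :
    D.θ X ∈ rootSpace D.𝔞 (-α) := by
  intro v
  have h := congrArg D.θ (hX v)
  rw [LieHom.map_lie, D.𝔞_le_𝔭 _ v.2, neg_lie, map_smul] at h
  rw [LinearMap.neg_apply, neg_smul, ← h, neg_neg]

lemma rootSpace_neg_ne_bot {α : Module.Dual ℝ D.𝔞} (hα : rootSpace D.𝔞 α ≠ ⊥) :
    rootSpace D.𝔞 (-α) ≠ ⊥ := by
  obtain ⟨X, hX, hX0⟩ := Submodule.exists_mem_ne_zero_of_ne_bot hα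
  refine (Submodule.ne_bot_iff _).2 ⟨D.θ X, D.θ_mem_rootSpace hX, fun h => hX0 ?_⟩
  rw [← D.θ_θ X, h, map_zero]

lemma rootSpace_le_𝔫 {α : Module.Dual ℝ D.𝔞} (hα : 0 < α D.H₀) : rootSpace D.𝔞 α ≤ D.𝔫 := by
  by_cases h : rootSpace D.𝔞 α = ⊥
  · exact h ▸ bot_le
  · refine le_iSup₂_of_le (f := fun (α : Module.Dual ℝ D.𝔞)
      (_ : α ∈ {α : Module.Dual ℝ D.𝔞 | IsRoot D.𝔞 α ∧ 0 < α D.H₀}) => rootSpace D.𝔞 α)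
      α ⟨⟨?_, h⟩, hα⟩ le_rfl
    rintro rfl
    exact lt_irrefl _ hα

/-- The Lie algebra `𝔨` of `K`, as the fixed space of the Cartan involution. -/
def 𝔨 : Submodule ℝ (lieAlg G) := LinearMap.eqLocus (D.θ : lieAlg G →ₗ[ℝ] lieAlg G) LinearMap.id

lemma add_θ_mem_𝔨 (X : lieAlg G) : X + D.θ X ∈ D.𝔨 := by
  change D.θ (X + D.θ X) = X + D.θ X
  rw [map_add, D.θ_θ, add_comm]

lemma mem_𝔞_of_lie_eq_zero {Y : lieAlg G} (hθ : D.θ Y = -Y) (hY : ∀ v ∈ D.𝔞, ⁅v, Y⁆ = 0) :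
    Y ∈ D.𝔞 := by
  rw [← D.𝔞_maximal (D.𝔞 ⊔ Submodule.span ℝ {Y}) ?_ ?_ le_sup_left]
  · exact Submodule.mem_sup_right (Submodule.mem_span_singleton_self Y)
  · intro Z hZ
    obtain ⟨v, hv, w, hw, rfl⟩ := Submodule.mem_sup.1 hZ
    obtain ⟨c, rfl⟩ := Submodule.mem_span_singleton.1 hw
    rw [map_add, map_smul, D.𝔞_le_𝔭 v hv, hθ, smul_neg, neg_add]
  · intro Z hZ Z' hZ'
    obtain ⟨v, hv, w, hw, rfl⟩ := Submodule.mem_sup.1 hZ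
    obtain ⟨c, rfl⟩ := Submodule.mem_span_singleton.1 hw
    obtain ⟨v', hv', w', hw', rfl⟩ := Submodule.mem_sup.1 hZ'
    obtain ⟨c', rfl⟩ := Submodule.mem_span_singleton.1 hw'
    have hv'Y : ⁅Y, v'⁆ = 0 := by rw [← lie_skew, hY v' hv', neg_zero]
    simp [D.𝔞_abelian v hv v' hv', hY v hv, hv'Y]

lemma rootSpace_zero_le : rootSpace D.𝔞 0 ≤ D.𝔨 ⊔ D.𝔞 := by
  intro X hX
  have hmem : X - D.θ X ∈ D.𝔞 := by
    refine D.mem_𝔞_of_lie_eq_zero (by rw [map_sub, D.θ_θ, neg_sub]) fun v hv => ?_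
    have hXv := hX ⟨v, hv⟩
    have hθXv := D.θ_mem_rootSpace hX ⟨v, hv⟩
    simp only [LinearMap.zero_apply, neg_zero, zero_smul] at hXv hθXv
    rw [lie_sub, hXv, hθXv, sub_zero]
  have hX2 : X = (1 / 2 : ℝ) • (X + D.θ X) + (1 / 2 : ℝ) • (X - D.θ X) := by
    rw [← smul_add, add_add_sub_cancel, ← two_smul ℝ X, smul_smul]
    norm_num
  rw [hX2]
  exact Submodule.add_mem_sup (D.𝔨.smul_mem _ (D.add_θ_mem_𝔨 X)) (D.𝔞.smul_mem _ hmem)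

lemma rootSpace_le_𝔨_sup_𝔫 {α : Module.Dual ℝ D.𝔞} (hα : α D.H₀ < 0) :
    rootSpace D.𝔞 α ≤ D.𝔨 ⊔ D.𝔫 := by
  intro X hX
  have hθX : D.θ X ∈ D.𝔫 := D.rootSpace_le_𝔫 (α := -α) (neg_pos.2 hα) (D.θ_mem_rootSpace hX)
  rw [← add_sub_cancel_right X (D.θ X), sub_eq_add_neg]
  exact Submodule.add_mem_sup (D.add_θ_mem_𝔨 X) (D.𝔫.neg_mem hθX)

lemma 𝔨_sup_𝔞_sup_𝔫 : D.𝔨 ⊔ D.𝔞 ⊔ D.𝔫 = ⊤ := by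
  refine top_unique (D.iSup_rootSpace.ge.trans (iSup_le fun α => ?_))
  by_cases h0 : α = 0
  · exact h0 ▸ D.rootSpace_zero_le.trans le_sup_left
  rcases lt_trichotomy (α D.H₀) 0 with hneg | hzero | hpos
  · exact (D.rootSpace_le_𝔨_sup_𝔫 hneg).trans (sup_le_sup_right le_sup_left _)
  · have hbot : rootSpace D.𝔞 α = ⊥ := by
      by_contra hne
      exact D.H₀_regular α ⟨h0, hne⟩ hzero
    exact hbot ▸ bot_le
  · exact (D.rootSpace_le_𝔫 hpos).trans le_sup_right

/-- The sum of the eigenspaces of `ad H₀` with eigenvalue in `s`. -/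
def eigenSum (s : Set ℝ) : Submodule ℝ (lieAlg G) :=
  ⨆ c ∈ s, Module.End.eigenspace (LieAlgebra.ad ℝ (lieAlg G) (D.H₀ : lieAlg G)) c

lemma mem_eigenSum {s : Set ℝ} {c : ℝ} (hc : c ∈ s) {X : lieAlg G}
    (hX : ⁅(D.H₀ : lieAlg G), X⁆ = c • X) : X ∈ D.eigenSum s :=
  (le_iSup₂_of_le (f := fun (c : ℝ) (_ : c ∈ s) => Module.End.eigenspace
    (LieAlgebra.ad ℝ (lieAlg G) (D.H₀ : lieAlg G)) c) c hc le_rfl)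
    (Module.End.mem_eigenspace_iff.2 hX)

lemma eigenSum_le {s : Set ℝ} {p : Submodule ℝ (lieAlg G)}
    (h : ∀ c ∈ s, ∀ X, ⁅(D.H₀ : lieAlg G), X⁆ = c • X → X ∈ p) : D.eigenSum s ≤ p :=
  iSup₂_le fun c hc X hX => h c hc X (Module.End.mem_eigenspace_iff.1 hX)

lemma eigenSum_Ioi_le_Ici (c : ℝ) : D.eigenSum (Set.Ioi c) ≤ D.eigenSum (Set.Ici c) :=
  D.eigenSum_le fun _ hd _ hX => D.mem_eigenSum (Set.Ioi_subset_Ici_self hd) hX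

lemma lie_mem_eigenSum_of_mem_𝔫 {Z Y : lieAlg G} (hZ : Z ∈ D.𝔫) {c : ℝ}
    (hY : Y ∈ D.eigenSum (Set.Ici c)) : ⁅Z, Y⁆ ∈ D.eigenSum (Set.Ioi c) := by
  refine D.eigenSum_le (p := (D.eigenSum (Set.Ioi c)).comap
    (LieAlgebra.ad ℝ (lieAlg G) Z : lieAlg G →ₗ[ℝ] lieAlg G)) (fun d hd Y hY => ?_) hY
  have hle : D.𝔫 ≤ (D.eigenSum (Set.Ioi c)).comap
      (LieAlgebra.ad ℝ (lieAlg G) Y : lieAlg G →ₗ[ℝ] lieAlg G) := by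
    refine iSup₂_le fun α hα Z hZ => D.mem_eigenSum (c := d + α D.H₀) ?_ ?_
    · exact lt_of_le_of_lt hd (lt_add_of_pos_right d hα.2)
    · rw [LieAlgebra.ad_apply, leibniz_lie, hY, hZ D.H₀, smul_lie, lie_smul, add_smul]
  change ⁅Z, Y⁆ ∈ D.eigenSum _
  rw [← lie_skew]
  exact Submodule.neg_mem _ (hle hZ)

lemma lie_mem_eigenSum_of_mem_𝔞 {v Y : lieAlg G} (hv : v ∈ D.𝔞) {s : Set ℝ}
    (hY : Y ∈ D.eigenSum s) : ⁅v, Y⁆ ∈ D.eigenSum s := by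
  refine D.eigenSum_le (p := (D.eigenSum s).comap
    (LieAlgebra.ad ℝ (lieAlg G) v : lieAlg G →ₗ[ℝ] lieAlg G)) (fun d hd Y hY => ?_) hY
  refine D.mem_eigenSum hd ?_
  rw [LieAlgebra.ad_apply, leibniz_lie, D.𝔞_abelian _ D.H₀.2 _ hv, zero_lie, zero_add, hY, lie_smul]

lemma killingForm_θ_eigenSum_Ioi {X Y : lieAlg G} {c : ℝ}
    (hX : ⁅(D.H₀ : lieAlg G), X⁆ = c • X) (hY : Y ∈ D.eigenSum (Set.Ioi c)) :
    killingForm ℝ (lieAlg G) (D.θ X) Y = 0 := by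
  refine D.eigenSum_le (p := LinearMap.ker (killingForm ℝ (lieAlg G) (D.θ X)))
    (fun d hd Y hY => ?_) hY
  have hθX : ⁅(D.H₀ : lieAlg G), D.θ X⁆ = -(c • D.θ X) := by
    rw [← neg_eq_iff_eq_neg, ← neg_lie, ← D.𝔞_le_𝔭 _ D.H₀.2, ← LieHom.map_lie, hX, map_smul]
  have hinv := LieModule.traceForm_apply_lie_apply' ℝ (lieAlg G) (lieAlg G)
    (D.H₀ : lieAlg G) (D.θ X) Y
  rw [hθX, hY, map_neg, map_smul, map_smul, LinearMap.neg_apply, LinearMap.smul_apply,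
    smul_eq_mul, smul_eq_mul, neg_inj] at hinv
  by_contra hne
  exact (Set.mem_Ioi.1 hd).ne (mul_right_cancel₀ hne hinv)

section Closed

variable [Fact (IsClosed (G : Set (GL (Fin n) ℝ)))]

lemma Ad_N_sub_mem {u : G} (hu : u ∈ D.N) {c : ℝ} {Y : lieAlg G}
    (hY : Y ∈ D.eigenSum (Set.Ici c)) : Ad u Y - Y ∈ D.eigenSum (Set.Ioi c) := by
  let p : G → Prop := fun u => ∀ Y ∈ D.eigenSum (Set.Ici c), Ad u Y - Y ∈ D.eigenSum (Set.Ioi c)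
  have hexp (Z) (hZ : Z ∈ D.𝔫) : p (expG Z) := fun Y hY =>
    Ad_expG_sub_mem (D.eigenSum_Ioi_le_Ici c) (fun Y hY => D.lie_mem_eigenSum_of_mem_𝔫 hZ hY) hY
  have hmul (a b : G) (ha : p a) (hb : p b) : p (a * b) := fun Y hY => by
    have hbY : Ad b Y ∈ D.eigenSum (Set.Ici c) := by
      simpa using add_mem (D.eigenSum_Ioi_le_Ici c (hb Y hY)) hY
    have hadd := add_mem (ha _ hbY) (hb Y hY)
    rwa [sub_add_sub_cancel, ← Ad_mul] at hadd
  have hboth : p u ∧ p u⁻¹ := by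
    refine Subgroup.closure_induction (p := fun u _ => p u ∧ p u⁻¹) ?_ ?_ ?_ ?_ hu
    · rintro g ⟨Z, hZ, hg⟩
      rw [eq_expG hg, ← expG_neg]
      exact ⟨hexp Z hZ, hexp _ (D.𝔫.neg_mem hZ)⟩
    · rw [inv_one, and_self, ← expG_zero]
      exact hexp 0 D.𝔫.zero_mem
    · intro a b _ _ ha hb
      rw [mul_inv_rev]
      exact ⟨hmul _ _ ha.1 hb.1, hmul _ _ hb.2 ha.2⟩
    · intro a _ ha
      rw [inv_inv]
      exact ha.symm
  exact hboth.1 Y hY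

lemma killingForm_θ_Ad_expG_mul {α : Module.Dual ℝ D.𝔞} {X : lieAlg G}
    (hX : X ∈ rootSpace D.𝔞 α) (w : D.𝔞) {u : G} (hu : u ∈ D.N) :
    killingForm ℝ (lieAlg G) (D.θ X) (Ad (expG w * u) X) =
      Real.exp (α w) * killingForm ℝ (lieAlg G) (D.θ X) X := by
  have hY := D.Ad_N_sub_mem hu (D.mem_eigenSum (Set.self_mem_Ici (a := α D.H₀)) (hX D.H₀))
  have hAdY : Ad (expG w) (Ad u X - X) ∈ D.eigenSum (Set.Ioi (α D.H₀)) := by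
    simpa using add_mem (Ad_expG_sub_mem le_rfl
      (fun Y hY => D.lie_mem_eigenSum_of_mem_𝔞 w.2 (s := Set.Ioi (α D.H₀)) hY) hY) hY
  rw [Ad_mul, ← add_sub_cancel X (Ad u X), map_add, map_add,
    D.killingForm_θ_eigenSum_Ioi (hX D.H₀) hAdY, add_zero, Ad_expG_of_lie_eq_smul (hX w), map_smul,
    smul_eq_mul]

omit D in
lemma Ad_eq_self_iff {g : G} {X : lieAlg G} :
    Ad g X = X ↔ toMat g * (X : Matrix (Fin n) (Fin n) ℝ) = X * toMat g := by
  rw [← SetLike.coe_eq_coe, coe_Ad]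
  constructor
  · intro h
    nth_rewrite 2 [← h]
    rw [mul_assoc, toMat_inv_mul, mul_one]
  · intro h
    rw [h, mul_assoc, toMat_mul_inv, mul_one]

lemma conj_mem_N {g : G} (hg : ∀ X ∈ D.𝔞, Ad g X = X) {u : G} (hu : u ∈ D.N) :
    g * u * g⁻¹ ∈ D.N := by
  have h𝔫 : D.𝔫 ≤ D.𝔫.comap ((Ad g : lieAlg G →ₗ⁅ℝ⁆ lieAlg G) : lieAlg G →ₗ[ℝ] lieAlg G) := by
    refine iSup₂_le fun α hα X hX => D.rootSpace_le_𝔫 hα.2 fun v => ?_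
    change ⁅(v : lieAlg G), Ad g X⁆ = α v • Ad g X
    rw [← map_smul, ← hX v, LieEquiv.map_lie, hg _ v.2]
  refine (Subgroup.closure_le (K := D.N.comap (MulAut.conj g).toMonoidHom)).2 ?_ hu
  rintro h ⟨Z, hZ, hh⟩
  change g * h * g⁻¹ ∈ D.N
  rw [eq_expG hh, conj_expG]
  exact Subgroup.subset_closure ⟨_, h𝔫 hZ, toMat_expG _⟩

lemma Ad_expG_eq_self (v : D.𝔞) {X : lieAlg G} (hX : X ∈ D.𝔞) : Ad (expG v) X = X := by
  simpa using Ad_expG_of_lie_eq_smul (Z := (v : lieAlg G)) (Y := X) (c := 0)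
    (by rw [D.𝔞_abelian _ v.2 _ hX, zero_smul])

lemma expG_𝔞_add (v w : D.𝔞) : expG ((v + w : D.𝔞) : lieAlg G) = expG v * expG w :=
  expG_add (D.𝔞_abelian _ v.2 _ w.2)

lemma exists_N_mul_expG_eq (v : D.𝔞) {u : G} (hu : u ∈ D.N) :
    ∃ u' ∈ D.N, u * expG v = expG v * u' := by
  refine ⟨(expG v)⁻¹ * u * expG v, ?_, by group⟩
  have hconj := D.conj_mem_N (fun X hX => D.Ad_expG_eq_self (-v) hX) hu
  rwa [Submodule.coe_neg, expG_neg, inv_inv] at hconj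

lemma exists_expG_mul_pow_eq (w : D.𝔞) {u : G} (hu : u ∈ D.N) (j : ℕ) :
    ∃ u' ∈ D.N, (expG w * u) ^ j = expG (((j : ℝ) • w : D.𝔞) : lieAlg G) * u' := by
  induction j with
  | zero => exact ⟨1, D.N.one_mem, by simp [expG_zero]⟩
  | succ j ih =>
    obtain ⟨u', hu', hj⟩ := ih
    obtain ⟨u'', hu'', hcomm⟩ := D.exists_N_mul_expG_eq w hu'
    refine ⟨u'' * u, D.N.mul_mem hu'' hu, ?_⟩
    rw [pow_succ, hj, Nat.cast_succ, add_smul, one_smul, expG_𝔞_add, mul_assoc, ← mul_assoc u',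
      hcomm]
    simp only [mul_assoc]

/- A positive root would make the matrix coefficients of the powers of `exp w · u`, which stay in
the compact group `K`, grow exponentially. -/
lemma root_nonpos_of_expG_mul_mem_K {w : D.𝔞} {u : G} (hu : u ∈ D.N) (hK : expG w * u ∈ D.K)
    {α : Module.Dual ℝ D.𝔞} (hα : rootSpace D.𝔞 α ≠ ⊥) : α w ≤ 0 := by
  obtain ⟨X, hX, hX0⟩ := Submodule.exists_mem_ne_zero_of_ne_bot hα
  by_contra! hpos
  have hcont : Continuous fun g : G => killingForm ℝ (lieAlg G) (D.θ X) (Ad g X) :=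
    (LinearMap.continuous_of_finiteDimensional (killingForm ℝ (lieAlg G) (D.θ X))).comp
      (continuous_Ad X)
  obtain ⟨C, hC⟩ := (D.isCompact_K.image hcont).isBounded.exists_norm_le
  have hne : killingForm ℝ (lieAlg G) (D.θ X) X ≠ 0 := by
    rw [LieModule.traceForm_comm]
    exact (D.killing_θ_neg X hX0).ne
  have hbound (j : ℕ) : Real.exp (j * α w) * |killingForm ℝ (lieAlg G) (D.θ X) X| ≤ C := by
    obtain ⟨u', hu', hj⟩ := D.exists_expG_mul_pow_eq w hu j
    have hle := hC _ ⟨_, D.K.pow_mem hK j, rfl⟩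
    beta_reduce at hle
    rwa [hj, D.killingForm_θ_Ad_expG_mul hX _ hu', map_smul, smul_eq_mul, norm_mul,
      Real.norm_of_nonneg (Real.exp_nonneg _)] at hle
  have htend : Tendsto (fun j : ℕ => Real.exp (j * α w) *
      |killingForm ℝ (lieAlg G) (D.θ X) X|) atTop atTop :=
    (Real.tendsto_exp_atTop.comp (tendsto_natCast_atTop_atTop.atTop_mul_const hpos)).atTop_mul_const
      (abs_pos.2 hne)
  obtain ⟨j, hj⟩ := (htend.eventually_gt_atTop C).exists
  exact (hbound j).not_gt hj

omit [Fact (IsClosed (G : Set (GL (Fin n) ℝ)))] in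
lemma eq_zero_of_forall_root_eq_zero {w : D.𝔞}
    (hw : ∀ α : Module.Dual ℝ D.𝔞, rootSpace D.𝔞 α ≠ ⊥ → α w = 0) : w = 0 := by
  have hle : ⊤ ≤ LinearMap.ker
      (LieAlgebra.ad ℝ (lieAlg G) (w : lieAlg G) : lieAlg G →ₗ[ℝ] lieAlg G) := by
    rw [← D.iSup_rootSpace]
    refine iSup_le fun α X hX => ?_
    rw [LinearMap.mem_ker, LieAlgebra.ad_apply, hX w]
    by_cases hα : rootSpace D.𝔞 α = ⊥
    · rw [(Submodule.eq_bot_iff _).1 hα X hX, smul_zero]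
    · rw [hw α hα, zero_smul]
  have had : LieAlgebra.ad ℝ (lieAlg G) (w : lieAlg G) = 0 :=
    LinearMap.ext fun X => hle Submodule.mem_top
  by_contra hw0
  have hneg := D.killing_θ_neg w (fun h => hw0 (Subtype.ext h))
  rw [killingForm_apply_apply, had, LinearMap.zero_comp, map_zero] at hneg
  exact lt_irrefl _ hneg

lemma eq_zero_of_expG_mul_mem_K {w : D.𝔞} {u : G} (hu : u ∈ D.N) (hK : expG w * u ∈ D.K) :
    w = 0 := by
  refine D.eq_zero_of_forall_root_eq_zero fun α hα => ?_
  refine le_antisymm (D.root_nonpos_of_expG_mul_mem_K hu hK hα) ?_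
  simpa using D.root_nonpos_of_expG_mul_mem_K hu hK (D.rootSpace_neg_ne_bot hα)

lemma iwasawa_unique {k k' u u' : G} {v v' : D.𝔞} (hk : k ∈ D.K) (hk' : k' ∈ D.K) (hu : u ∈ D.N)
    (hu' : u' ∈ D.N) (h : k * expG v * u = k' * expG v' * u') : v = v' := by
  obtain ⟨u'', hu'', hcomm⟩ := D.exists_N_mul_expG_eq (-v) (D.N.mul_mem hu' (D.N.inv_mem hu))
  have hK : expG ((v' + -v : D.𝔞) : lieAlg G) * u'' = k'⁻¹ * k := by
    rw [expG_𝔞_add, mul_assoc, ← hcomm, Submodule.coe_neg, expG_neg, eq_inv_mul_iff_mul_eq]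
    simp only [← mul_assoc, ← h, mul_inv_cancel_right]
  have hzero := D.eq_zero_of_expG_mul_mem_K hu'' (hK ▸ D.K.mul_mem (D.K.inv_mem hk') hk)
  rw [← sub_eq_add_neg, sub_eq_zero] at hzero
  exact hzero.symm

lemma H_eq {g k u : G} {v : D.𝔞} (hk : k ∈ D.K) (hu : u ∈ D.N) (h : g = k * expG v * u) :
    D.H g = v := by
  have hex : ∃ v : D.𝔞, ∃ k ∈ D.K, ∃ a : G, ∃ u ∈ D.N,
      toMat a = NormedSpace.exp ((v : lieAlg G) : Matrix (Fin n) (Fin n) ℝ) ∧ g = k * a * u :=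
    ⟨v, k, hk, expG v, u, hu, toMat_expG _, h⟩
  obtain ⟨k', hk', a, u', hu', ha, hg⟩ := hex.choose_spec
  rw [eq_expG ha] at hg
  rw [show D.H g = hex.choose from dif_pos hex]
  exact D.iwasawa_unique hk' hk hu' hu (hg.symm.trans h)

end Closed

end CartanData

section LocalProduct

open scoped Matrix.Norms.Operator

lemma hasStrictFDerivAt_exp_comp {E 𝔸 : Type*} [NormedAddCommGroup E] [NormedSpace ℝ E]
    [NormedRing 𝔸] [NormedAlgebra ℝ 𝔸] [CompleteSpace 𝔸] (L : E →L[ℝ] 𝔸) :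
    HasStrictFDerivAt (fun e => NormedSpace.exp (L e)) L 0 := by
  have hexp : HasStrictFDerivAt (NormedSpace.exp : 𝔸 → 𝔸) (ContinuousLinearMap.id ℝ 𝔸) (L 0) := by
    rw [map_zero]
    exact hasStrictFDerivAt_exp_zero
  exact hexp.comp (0 : E) L.hasStrictFDerivAt

lemma hasStrictFDerivAt_mul_of_eq_one {E 𝔸 : Type*} [NormedAddCommGroup E] [NormedSpace ℝ E]
    [NormedRing 𝔸] [NormedAlgebra ℝ 𝔸] {a b : E → 𝔸} {a' b' : E →L[ℝ] 𝔸} {x : E}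
    (ha : HasStrictFDerivAt a a' x) (hb : HasStrictFDerivAt b b' x) (hax : a x = 1)
    (hbx : b x = 1) : HasStrictFDerivAt (fun e => a e * b e) (a' + b') x := by
  refine (ha.mul' hb).congr_fderiv (ContinuousLinearMap.ext fun e => ?_)
  change a x * b' e + a' e * b x = a' e + b' e
  rw [hax, hbx, one_mul, mul_one, add_comm]

/-- The operator norm on the Lie algebra. It is not an instance, so that statements only refer to
the subspace topology. -/
@[reducible]
def lieAlgNormedAddCommGroup (G : Subgroup (GL (Fin n) ℝ)) : NormedAddCommGroup (lieAlg G) :=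
  inferInstanceAs (NormedAddCommGroup (lieAlg G).toSubmodule)

variable [Fact (IsClosed (G : Set (GL (Fin n) ℝ)))]

lemma expG_image_mem_nhds {O : Set (lieAlg G)} (hO : O ∈ 𝓝 0) : expG '' O ∈ 𝓝 (1 : G) := by
  let _ := lieAlgNormedAddCommGroup G
  let _ : NormedSpace ℝ (lieAlg G) := inferInstanceAs (NormedSpace ℝ (lieAlg G).toSubmodule)
  refine image_mem_nhds_one (f' := (lieAlg G).toSubmodule.subtypeL) expG_zero ?_
    (fun X hX => ⟨⟨X, hX⟩, rfl⟩) hO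
  simp only [toMat_expG]
  exact hasStrictFDerivAt_exp_comp (lieAlg G).toSubmodule.subtypeL

lemma CartanData.iwasawa_mem_nhds (D : CartanData G) {O : Set D.𝔞} (hO : O ∈ 𝓝 0) :
    {g : G | ∃ Y ∈ D.𝔨, ∃ v ∈ O, ∃ Z ∈ D.𝔫, g = expG Y * expG (v : D.𝔞) * expG Z} ∈
      𝓝 (1 : G) := by
  let _ := lieAlgNormedAddCommGroup G
  let _ : NormedSpace ℝ (lieAlg G) := inferInstanceAs (NormedSpace ℝ (lieAlg G).toSubmodule)
  let E := D.𝔨 × D.𝔞 × D.𝔫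
  let ι := (lieAlg G).toSubmodule.subtypeL
  let L₁ : E →L[ℝ] Matrix (Fin n) (Fin n) ℝ := (ι.comp D.𝔨.subtypeL).comp (.fst ℝ _ _)
  let L₂ : E →L[ℝ] Matrix (Fin n) (Fin n) ℝ :=
    (ι.comp D.𝔞.subtypeL).comp ((ContinuousLinearMap.fst ℝ _ _).comp (.snd ℝ _ _))
  let L₃ : E →L[ℝ] Matrix (Fin n) (Fin n) ℝ :=
    (ι.comp D.𝔫.subtypeL).comp ((ContinuousLinearMap.snd ℝ _ _).comp (.snd ℝ _ _))
  let f : E → G := fun e => expG e.1 * expG e.2.1 * expG e.2.2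
  have hexp0 (L : E →L[ℝ] Matrix (Fin n) (Fin n) ℝ) : NormedSpace.exp (L 0) = 1 := by
    rw [map_zero, NormedSpace.exp_zero]
  have hf : HasStrictFDerivAt (fun e => toMat (f e)) (L₁ + L₂ + L₃) 0 := by
    simp only [f, toMat_mul, toMat_expG]
    exact hasStrictFDerivAt_mul_of_eq_one (hasStrictFDerivAt_mul_of_eq_one
      (hasStrictFDerivAt_exp_comp L₁) (hasStrictFDerivAt_exp_comp L₂) (hexp0 L₁) (hexp0 L₂))
      (hasStrictFDerivAt_exp_comp L₃) (by
        change NormedSpace.exp (L₁ 0) * NormedSpace.exp (L₂ 0) = 1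
        rw [hexp0, hexp0, one_mul]) (hexp0 L₃)
  have hU : {e : E | e.2.1 ∈ O} ∈ 𝓝 0 :=
    (continuous_fst.comp continuous_snd).continuousAt.preimage_mem_nhds hO
  refine mem_of_superset (image_mem_nhds_one (by simp [f, expG_zero]) hf (fun X hX => ?_) hU) ?_
  · obtain ⟨W, hW, Z, hZ, hWZ⟩ := Submodule.mem_sup.1
      (D.𝔨_sup_𝔞_sup_𝔫 ▸ Submodule.mem_top : (⟨X, hX⟩ : lieAlg G) ∈ D.𝔨 ⊔ D.𝔞 ⊔ D.𝔫)
    obtain ⟨Y, hY, v, hv, rfl⟩ := Submodule.mem_sup.1 hW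
    exact ⟨(⟨Y, hY⟩, ⟨v, hv⟩, ⟨Z, hZ⟩), congrArg Subtype.val hWZ⟩
  · rintro _ ⟨e, he, rfl⟩
    exact ⟨_, e.1.2, _, he, _, e.2.2.2, rfl⟩

end LocalProduct

section ProductOfSubgroups

open scoped Pointwise

variable {Q : Type*} [Group Q] [TopologicalSpace Q] [IsTopologicalGroup Q] {K R : Subgroup Q}

lemma isOpen_mul_of_mem_nhds_one (h : (K : Set Q) * (R : Set Q) ∈ 𝓝 1) :
    IsOpen ((K : Set Q) * (R : Set Q)) := by
  rw [isOpen_iff_mem_nhds]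
  rintro _ ⟨k, hk, r, hr, rfl⟩
  have hcont : Continuous fun x : Q => k⁻¹ * x * r⁻¹ := by fun_prop
  refine mem_of_superset (hcont.continuousAt.preimage_mem_nhds (x := k * r)
    (by simpa [mul_assoc] using h)) ?_
  rintro x ⟨k', hk', r', hr', (hx : k' * r' = k⁻¹ * x * r⁻¹)⟩
  refine ⟨k * k', K.mul_mem hk hk', r' * r, R.mul_mem hr' hr, ?_⟩
  calc k * k' * (r' * r) = k * (k' * r') * r := by group
    _ = k * (k⁻¹ * x * r⁻¹) * r := by rw [hx]
    _ = x := by group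

lemma isClosed_mul_of_mem_nhds_one (hK : IsCompact (K : Set Q))
    (h : (K : Set Q) * (R : Set Q) ∈ 𝓝 1) : IsClosed ((K : Set Q) * (R : Set Q)) := by
  have hsub : closure ((K : Set Q) * (R : Set Q)) ⊆ (K : Set Q) * closure (R : Set Q) :=
    closure_minimal (Set.mul_subset_mul_left subset_closure)
      (isClosed_closure.mul_left_of_isCompact hK)
  refine isClosed_of_closure_subset fun g hg => ?_
  obtain ⟨k, hk, s, hs, rfl⟩ := hsub hg
  have hnhds : (fun x : Q => s * x⁻¹) ⁻¹' ((K : Set Q) * (R : Set Q)) ∈ 𝓝 s :=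
    ContinuousAt.preimage_mem_nhds (by fun_prop) (by simpa using h)
  obtain ⟨r, ⟨k', hk', r', hr', (hsr : k' * r' = s * r⁻¹)⟩, hr⟩ :=
    mem_closure_iff_nhds.1 hs _ hnhds
  refine ⟨k * k', K.mul_mem hk hk', r' * r, R.mul_mem hr' hr, ?_⟩
  calc k * k' * (r' * r) = k * (k' * r') * r := by group
    _ = k * (s * r⁻¹) * r := by rw [hsr]
    _ = k * s := by group

lemma mul_eq_univ_of_mem_nhds_one [ConnectedSpace Q] (hK : IsCompact (K : Set Q))
    (h : (K : Set Q) * (R : Set Q) ∈ 𝓝 1) : (K : Set Q) * (R : Set Q) = Set.univ :=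
  IsClopen.eq_univ ⟨isClosed_mul_of_mem_nhds_one hK h, isOpen_mul_of_mem_nhds_one h⟩
    ⟨1, mem_of_mem_nhds h⟩

end ProductOfSubgroups

namespace CartanData

variable (D : CartanData G) [Fact (IsClosed (G : Set (GL (Fin n) ℝ)))]

lemma expG_mem_K {Y : lieAlg G} (hY : Y ∈ D.𝔨) : expG Y ∈ D.K := by
  obtain ⟨k, hk, hkY⟩ := (D.θ_fixed_iff Y).1 hY 1
  rw [one_smul] at hkY
  rwa [← eq_expG hkY]

lemma expG_mem_N {Z : lieAlg G} (hZ : Z ∈ D.𝔫) : expG Z ∈ D.N :=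
  Subgroup.subset_closure ⟨Z, hZ, toMat_expG Z⟩

/-- The solvable part `AN` of the Iwasawa decomposition, for closed `G`. -/
def AN : Subgroup G where
  carrier := {g | ∃ v : D.𝔞, ∃ u ∈ D.N, g = expG v * u}
  one_mem' := ⟨0, 1, D.N.one_mem, by simp [expG_zero]⟩
  mul_mem' := by
    rintro _ _ ⟨v, u, hu, rfl⟩ ⟨w, t, ht, rfl⟩
    obtain ⟨u', hu', hcomm⟩ := D.exists_N_mul_expG_eq w hu
    refine ⟨v + w, u' * t, D.N.mul_mem hu' ht, ?_⟩
    rw [expG_𝔞_add, mul_assoc, ← mul_assoc u, hcomm]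
    simp only [mul_assoc]
  inv_mem' := by
    rintro _ ⟨v, u, hu, rfl⟩
    obtain ⟨u', hu', hcomm⟩ := D.exists_N_mul_expG_eq (-v) (D.N.inv_mem hu)
    exact ⟨-v, u', hu', by rw [mul_inv_rev, ← hcomm, Submodule.coe_neg, expG_neg]⟩

lemma exists_iwasawa [ConnectedSpace G] (g : G) :
    ∃ k ∈ D.K, ∃ v : D.𝔞, ∃ u ∈ D.N, g = k * expG v * u := by
  open scoped Pointwise in
  have hnhds : (D.K : Set G) * (D.AN : Set G) ∈ 𝓝 1 := by
    refine mem_of_superset (D.iwasawa_mem_nhds (O := Set.univ) univ_mem) ?_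
    rintro _ ⟨Y, hY, v, -, Z, hZ, rfl⟩
    exact ⟨_, D.expG_mem_K hY, _, ⟨v, _, D.expG_mem_N hZ, rfl⟩, (mul_assoc _ _ _).symm⟩
  obtain ⟨k, hk, _, ⟨v, u, hu, rfl⟩, rfl⟩ :=
    (mul_eq_univ_of_mem_nhds_one D.isCompact_K hnhds).ge (Set.mem_univ g)
  exact ⟨k, hk, v, u, hu, (mul_assoc _ _ _).symm⟩

lemma H_of_mem_K {k : G} (hk : k ∈ D.K) : D.H k = 0 :=
  D.H_eq hk D.N.one_mem (by simp [expG_zero])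

variable [ConnectedSpace G]

lemma exists_eq_mul_expG_H_mul (g : G) : ∃ k ∈ D.K, ∃ u ∈ D.N, g = k * expG (D.H g) * u := by
  obtain ⟨k, hk, v, u, hu, h⟩ := D.exists_iwasawa g
  exact ⟨k, hk, u, hu, by rwa [D.H_eq hk hu h]⟩

lemma H_K_mul {k : G} (hk : k ∈ D.K) (g : G) : D.H (k * g) = D.H g := by
  obtain ⟨k', hk', u, hu, h⟩ := D.exists_eq_mul_expG_H_mul g
  exact D.H_eq (D.K.mul_mem hk hk') hu (by rw [mul_assoc, mul_assoc, ← mul_assoc k', ← h])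

lemma H_mul_expG_mul (x : G) (v : D.𝔞) {u : G} (hu : u ∈ D.N) :
    D.H (x * (expG v * u)) = D.H x + v := by
  obtain ⟨k, hk, t, ht, h⟩ := D.exists_eq_mul_expG_H_mul x
  obtain ⟨t', ht', hcomm⟩ := D.exists_N_mul_expG_eq v ht
  refine D.H_eq hk (D.N.mul_mem ht' hu) ?_
  calc x * (expG v * u) = k * expG (D.H x) * (t * expG v) * u := by
        nth_rewrite 1 [h]
        simp only [mul_assoc]
    _ = k * expG ((D.H x + v : D.𝔞) : lieAlg G) * (t' * u) := by
        rw [hcomm, expG_𝔞_add]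
        simp only [mul_assoc]

lemma H_mul_expG (x : G) (v : D.𝔞) : D.H (x * expG v) = D.H x + v := by
  simpa using D.H_mul_expG_mul x v D.N.one_mem

lemma H_mul_N (x : G) {u : G} (hu : u ∈ D.N) : D.H (x * u) = D.H x := by
  simpa [expG_zero] using D.H_mul_expG_mul x 0 hu

lemma H_mul_M (x : G) {m : G} (hm : m ∈ D.M) : D.H (x * m) = D.H x := by
  have hAd {m : G} (hm : m ∈ D.M) (X) (hX : X ∈ D.𝔞) : Ad m X = X :=
    Ad_eq_self_iff.2 (hm.2 X hX)
  obtain ⟨k, hk, t, ht, h⟩ := D.exists_eq_mul_expG_H_mul x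
  have ht' : m⁻¹ * t * m ∈ D.N := by simpa using D.conj_mem_N (hAd (D.M.inv_mem hm)) ht
  have hcomm : m * expG (D.H x) = expG (D.H x) * m := by
    rw [← mul_inv_eq_iff_eq_mul, conj_expG, hAd hm _ (D.H x).2]
  refine D.H_eq (D.K.mul_mem hk hm.1) ht' ?_
  calc x * m = k * (expG (D.H x) * m) * (m⁻¹ * t * m) := by
        nth_rewrite 1 [h]
        group
    _ = k * m * expG (D.H x) * (m⁻¹ * t * m) := by
        rw [← hcomm]
        simp only [mul_assoc]

lemma H_sub_H_mul_P (x y : G) {p : G} (hp : p ∈ D.P) :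
    D.H (x * p) - D.H (y * p) = D.H x - D.H y := by
  let Q : Subgroup G :=
    { carrier := {p | ∀ x y, D.H (x * p) - D.H (y * p) = D.H x - D.H y}
      mul_mem' := fun {a b} ha hb x y => by rw [← mul_assoc, ← mul_assoc, hb, ha]
      one_mem' := fun x y => by rw [mul_one, mul_one]
      inv_mem' := fun {a} ha x y => by
        rw [← ha (x * a⁻¹) (y * a⁻¹), inv_mul_cancel_right, inv_mul_cancel_right] }
  refine (sup_le (sup_le (fun m hm x y => ?_) ?_) fun u hu x y => ?_ : D.P ≤ Q) hp x y
  · rw [D.H_mul_M x hm, D.H_mul_M y hm]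
  · refine (Subgroup.closure_le _).2 ?_
    rintro a ⟨X, hX, ha⟩ x y
    have hH (z : G) : D.H (z * a) = D.H z + ⟨X, hX⟩ := eq_expG ha ▸ D.H_mul_expG z ⟨X, hX⟩
    rw [hH, hH, add_sub_add_right_eq_sub]
  · rw [D.H_mul_N x hu, D.H_mul_N y hu]

lemma exists_H_mul_eq_add (g : G) : ∃ k ∈ D.K, ∀ x, D.H (x * g) = D.H (x * k) + D.H g := by
  obtain ⟨k, hk, u, hu, h⟩ := D.exists_eq_mul_expG_H_mul g
  refine ⟨k, hk, fun x => ?_⟩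
  rw [← D.H_mul_expG_mul (x * k) (D.H g) hu]
  nth_rewrite 1 [h]
  simp only [mul_assoc]

lemma continuous_H : Continuous D.H := by
  have hone : ContinuousAt D.H 1 := by
    rw [ContinuousAt, D.H_of_mem_K D.K.one_mem]
    intro O hO
    refine mem_map.2 (mem_of_superset (D.iwasawa_mem_nhds hO) ?_)
    rintro _ ⟨Y, hY, v, hv, Z, hZ, rfl⟩
    rwa [Set.mem_preimage, D.H_eq (D.expG_mem_K hY) (D.expG_mem_N hZ) rfl]
  refine continuous_iff_continuousAt.2 fun g => ?_
  obtain ⟨k, hk, hkg⟩ := D.exists_H_mul_eq_add g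
  have heq : D.H = fun x => D.H (k⁻¹ * (x * g⁻¹) * k) + D.H g := by
    ext1 x
    rw [mul_assoc, D.H_K_mul (D.K.inv_mem hk), ← hkg, inv_mul_cancel_right]
  have hcont : Continuous fun x : G => k⁻¹ * (x * g⁻¹) * k := by fun_prop
  rw [heq]
  refine ContinuousAt.add (ContinuousAt.comp (g := D.H) ?_ hcont.continuousAt) continuousAt_const
  simpa using hone

end CartanData

lemma continuous_bilinForm_self {V : Type*} [AddCommGroup V] [Module ℝ V] [TopologicalSpace V]
    [IsTopologicalAddGroup V] [ContinuousSMul ℝ V] [T2Space V] [FiniteDimensional ℝ V]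
    (B : LinearMap.BilinForm ℝ V) : Continuous fun x => B x x := by
  let b := Module.finBasis ℝ V
  have hsum : (fun x => B x x) = fun x => ∑ i, b.coord i x * B (b i) x := by
    funext x
    have hexpand := congrArg (fun y => B y x) (b.sum_repr x)
    simpa only [map_sum, LinearMap.sum_apply, map_smul, LinearMap.smul_apply, smul_eq_mul,
      Module.Basis.coord_apply] using hexpand.symm
  rw [hsum]
  exact continuous_finsetSum _ fun i _ =>
    (LinearMap.continuous_of_finiteDimensional (b.coord i)).mul
      (LinearMap.continuous_of_finiteDimensional (B (b i)))

namespace CartanData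

variable (D : CartanData G)

lemma continuous_pNorm : Continuous D.pNorm := by
  have hθ : Continuous D.θ :=
    LinearMap.continuous_of_finiteDimensional (D.θ : lieAlg G →ₗ[ℝ] lieAlg G)
  have hproj : Continuous fun Z : lieAlg G => (1 / 2 : ℝ) • (Z - D.θ Z) := by fun_prop
  exact Real.continuous_sqrt.comp ((continuous_bilinForm_self _).comp hproj)

lemma pNorm_nonneg (X : lieAlg G) : 0 ≤ D.pNorm X := Real.sqrt_nonneg _

lemma dist_le_of_isCurveLength {x y : D.X} {L : ℝ} (h : D.IsCurveLength x y L) :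
    D.dist x y ≤ L := by
  refine csInf_le ⟨0, ?_⟩ h
  rintro _ ⟨c, u, -, -, -, -, rfl⟩
  exact intervalIntegral.integral_nonneg zero_le_one fun t _ => D.pNorm_nonneg _

lemma isOpenQuotientMap_toX : IsOpenQuotientMap D.toX :=
  QuotientGroup.isOpenQuotientMap_mk

lemma isOpenQuotientMap_plus : IsOpenQuotientMap D.plus :=
  QuotientGroup.isOpenQuotientMap_mk

/-- The projection `G → G/M`. -/
def toGM (g : G) : D.GM := (QuotientGroup.mk g : G ⧸ D.M)

lemma isOpenQuotientMap_toGM : IsOpenQuotientMap D.toGM :=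
  QuotientGroup.isOpenQuotientMap_mk

instance : MulAction G D.GM := inferInstanceAs (MulAction G (G ⧸ D.M))
instance : ContinuousConstSMul G D.GM := inferInstanceAs (ContinuousConstSMul G (G ⧸ D.M))

lemma smul_toX (g h : G) : g • D.toX h = D.toX (g * h) := rfl

lemma smul_plus (g h : G) : g • D.plus h = D.plus (g * h) := rfl

lemma smul_minus (g h : G) : g • D.minus h = D.minus (g * h) :=
  congrArg D.plus (mul_assoc g h D.w₀).symm

lemma smul_toGM (g h : G) : g • D.toGM h = D.toGM (g * h) := rfl

lemma toX_mul_K (g : G) {k : G} (hk : k ∈ D.K) : D.toX (g * k) = D.toX g :=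
  QuotientGroup.mk_mul_of_mem g hk

lemma plus_mul_P (g : G) {p : G} (hp : p ∈ D.P) : D.plus (g * p) = D.plus g :=
  QuotientGroup.mk_mul_of_mem g hp

lemma toGM_mul_M (g : G) {m : G} (hm : m ∈ D.M) : D.toGM (g * m) = D.toGM g :=
  QuotientGroup.mk_mul_of_mem g hm

lemma exists_repX_eq (g : G) : ∃ k ∈ D.K, D.repX (D.toX g) = g * k := by
  obtain ⟨k, hk⟩ := QuotientGroup.mk_out_eq_mul D.K g
  exact ⟨k, k.2, hk⟩

lemma exists_repF_eq (g : G) : ∃ p ∈ D.P, D.repF (D.plus g) = g * p := by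
  obtain ⟨p, hp⟩ := QuotientGroup.mk_out_eq_mul D.P g
  exact ⟨p, p.2, hp⟩

lemma exists_repGM_eq (g : G) : ∃ m : D.M, D.repGM (D.toGM g) = g * m :=
  QuotientGroup.mk_out_eq_mul D.M g

lemma toGM_repGM (q : D.GM) : D.toGM (D.repGM q) = q :=
  Quotient.out_eq (s := QuotientGroup.leftRel D.M) q

lemma M_le_P : D.M ≤ D.P := le_sup_left.trans le_sup_left

lemma conj_w₀_mem_M {m : G} (hm : m ∈ D.M) : D.w₀⁻¹ * m * D.w₀ ∈ D.M := by
  refine ⟨D.K.mul_mem (D.K.mul_mem (D.K.inv_mem D.w₀_mem) hm.1) D.w₀_mem, fun X hX => ?_⟩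
  obtain ⟨u, hu⟩ := D.w₀_normalizes ⟨X, hX⟩
  have hw₀ : toMat D.w₀ * (X : Matrix (Fin n) (Fin n) ℝ) = (u : lieAlg G) * toMat D.w₀ := by
    rw [← hu, mul_assoc, toMat_inv_mul, mul_one]
  have hw₀' : (X : Matrix (Fin n) (Fin n) ℝ) * toMat D.w₀⁻¹ = toMat D.w₀⁻¹ * (u : lieAlg G) := by
    rw [← hu, mul_assoc, ← mul_assoc (toMat D.w₀⁻¹), toMat_inv_mul, one_mul]
  rw [toMat_mul, toMat_mul, mul_assoc, hw₀, mul_assoc, ← mul_assoc (toMat m), hm.2 _ u.2,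
    ← mul_assoc, ← mul_assoc, ← hw₀']
  simp only [mul_assoc]

lemma minus_mul_M (g : G) {m : G} (hm : m ∈ D.M) : D.minus (g * m) = D.minus g := by
  have hconj : g * m * D.w₀ = g * D.w₀ * (D.w₀⁻¹ * m * D.w₀) := by group
  change D.plus (g * m * D.w₀) = D.plus (g * D.w₀)
  rw [hconj, D.plus_mul_P _ (D.M_le_P (D.conj_w₀_mem_M hm))]

lemma continuous_plus : Continuous D.plus := D.isOpenQuotientMap_plus.continuous

lemma continuous_minus : Continuous D.minus := D.continuous_plus.comp (continuous_mul_const D.w₀)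

lemma busemann_add (ξ : D.F) (x y z : D.X) :
    D.busemann ξ x y + D.busemann ξ y z = D.busemann ξ x z :=
  sub_add_sub_cancel _ _ _

lemma neg_busemann (ξ : D.F) (x y : D.X) : -D.busemann ξ x y = D.busemann ξ y x :=
  neg_sub _ _

lemma hopf_toGM (g : G) : hopf D (D.toGM g) =
    (D.plus g, D.minus g, D.busemann (D.minus g) D.o (D.toX g)) := by
  obtain ⟨m, hm⟩ := D.exists_repGM_eq g
  rw [hopf, hm, D.plus_mul_P _ (D.M_le_P m.2), D.minus_mul_M _ m.2, D.toX_mul_K _ m.2.1]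

/-- The logarithm of the density of the Bowen-Margulis-Sullivan measure in Hopf coordinates. -/
def bmsLogDensity (ψ₁ ψ₂ : Module.Dual ℝ D.𝔞) (q : D.GM) : ℝ :=
  ψ₁ (D.busemann (D.plus (D.repGM q)) D.o (D.toX (D.repGM q))) +
    ψ₂ (D.busemann (D.minus (D.repGM q)) D.o (D.toX (D.repGM q)))

lemma bmsLogDensity_toGM (ψ₁ ψ₂ : Module.Dual ℝ D.𝔞) (g : G) :
    D.bmsLogDensity ψ₁ ψ₂ (D.toGM g) = ψ₁ (D.busemann (D.plus g) D.o (D.toX g)) +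
      ψ₂ (D.busemann (D.minus g) D.o (D.toX g)) := by
  obtain ⟨m, hm⟩ := D.exists_repGM_eq g
  rw [bmsLogDensity, hm, D.plus_mul_P _ (D.M_le_P m.2), D.minus_mul_M _ m.2,
    D.toX_mul_K _ m.2.1]

/-- The action of `g` in Hopf coordinates. -/
def hopfAction (g : G) (p : D.F × D.F × D.𝔞) : D.F × D.F × D.𝔞 :=
  (g • p.1, g • p.2.1, D.busemann (g • p.2.1) D.o (g • D.o) + p.2.2)

lemma hopfAction_one (p : D.F × D.F × D.𝔞) : D.hopfAction 1 p = p := by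
  simp [hopfAction, busemann]

variable [Fact (IsClosed (G : Set (GL (Fin n) ℝ)))]

open scoped Matrix.Norms.Operator in
lemma isCurveLength_expG (g : G) (X : lieAlg G) :
    D.IsCurveLength (D.toX g) (D.toX (g * expG X)) (D.pNorm X) := by
  refine ⟨fun t => g * expG (t • X), fun _ => X, continuous_const, fun t i j => ?_, ?_, ?_, ?_⟩
  · have hexp := (hasDerivAt_exp_smul_const (𝕂 := ℝ) (X : Matrix (Fin n) (Fin n) ℝ) t).const_mul
      (toMat g)
    have hentry := (LinearMap.toContinuousLinearMap
      (Matrix.entryLinearMap ℝ ℝ i j)).hasFDerivAt.comp_hasDerivAt t hexp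
    rw [← mul_assoc] at hentry
    simp only [toMat_mul, toMat_expG]
    exact hentry
  · simp [expG_zero]
  · simp
  · simp

lemma exists_nhds_dist_lt_one [LocallyCompactSpace G] :
    ∃ B C : Set G, IsOpen B ∧ (1 : G) ∈ B ∧ B ⊆ C ∧ IsCompact C ∧
      ∀ b ∈ B, ∀ g, D.dist (D.toX (g * b)) (D.toX g) < 1 := by
  obtain ⟨C, hC, hC1⟩ := exists_compact_mem_nhds (1 : G)
  have hsmall : {X : lieAlg G | D.pNorm (-X) < 1} ∈ 𝓝 0 :=
    (isOpen_lt (D.continuous_pNorm.comp continuous_neg) continuous_const).mem_nhds (by simp [pNorm])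
  obtain ⟨B, hB, hBo, h1B⟩ := mem_nhds_iff.1 (inter_mem (expG_image_mem_nhds hsmall) hC1)
  refine ⟨B, C, hBo, h1B, fun b hb => (hB hb).2, hC, fun b hb g => ?_⟩
  obtain ⟨X, hX, rfl⟩ := (hB hb).1
  have hlength := D.isCurveLength_expG (g * expG X) (-X)
  rw [expG_neg, mul_inv_cancel_right] at hlength
  exact (D.dist_le_of_isCurveLength hlength).trans_lt hX

variable [ConnectedSpace G]

lemma busemann_plus (h g g' : G) :
    D.busemann (D.plus h) (D.toX g) (D.toX g') = D.H (g⁻¹ * h) - D.H (g'⁻¹ * h) := by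
  obtain ⟨k, hk, hkg⟩ := D.exists_repX_eq g
  obtain ⟨k', hk', hkg'⟩ := D.exists_repX_eq g'
  obtain ⟨p, hp, hph⟩ := D.exists_repF_eq h
  rw [busemann, hkg, hkg', hph, mul_inv_rev, mul_inv_rev, mul_assoc, mul_assoc,
    D.H_K_mul (D.K.inv_mem hk), D.H_K_mul (D.K.inv_mem hk'), ← mul_assoc, ← mul_assoc,
    D.H_sub_H_mul_P _ _ hp]

lemma busemann_smul (g : G) (ξ : D.F) (x y : D.X) :
    D.busemann (g • ξ) (g • x) (g • y) = D.busemann ξ x y := by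
  obtain ⟨h, rfl⟩ := D.isOpenQuotientMap_plus.surjective ξ
  obtain ⟨a, rfl⟩ := D.isOpenQuotientMap_toX.surjective x
  obtain ⟨b, rfl⟩ := D.isOpenQuotientMap_toX.surjective y
  rw [smul_plus, smul_toX, smul_toX, D.busemann_plus, D.busemann_plus]
  simp [mul_assoc]

lemma busemann_smul_eq_add (g : G) (ξ : D.F) (x y : D.X) :
    D.busemann (g • ξ) x (g • y) = D.busemann (g • ξ) x (g • x) + D.busemann ξ x y := by
  rw [← D.busemann_smul g ξ x y, busemann_add]

lemma continuous_busemann (x : D.X) :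
    Continuous fun p : D.F × D.X => D.busemann p.1 x p.2 := by
  obtain ⟨a, rfl⟩ := D.isOpenQuotientMap_toX.surjective x
  rw [(D.isOpenQuotientMap_plus.prodMap D.isOpenQuotientMap_toX).isQuotientMap.continuous_iff]
  have hlift : (fun p : D.F × D.X => D.busemann p.1 (D.toX a) p.2) ∘ Prod.map D.plus D.toX =
      fun p : G × G => D.H (a⁻¹ * p.1) - D.H (p.2⁻¹ * p.1) :=
    funext fun p => D.busemann_plus _ _ _
  have hH := D.continuous_H
  rw [hlift]
  fun_prop

lemma continuous_busemann_comp {Y : Type*} [TopologicalSpace Y] {ξ : Y → D.F} {x : Y → D.X}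
    (hξ : Continuous ξ) (y : D.X) (hx : Continuous x) :
    Continuous fun t => D.busemann (ξ t) y (x t) :=
  Continuous.comp (g := fun p : D.F × D.X => D.busemann p.1 y p.2) (f := fun t => (ξ t, x t))
    (D.continuous_busemann y) (hξ.prodMk hx)

lemma exists_isCompact_busemann_mem {C : Set G} (hC : IsCompact C) :
    ∃ L : Set D.𝔞, IsCompact L ∧ ∀ b ∈ C, ∀ (g : G) (ξ : D.F),
      D.busemann ξ (D.toX (g * b)) (D.toX g) ∈ L := by
  have hH := D.continuous_H
  refine ⟨(fun p : G × G => D.H (p.1⁻¹ * p.2)) '' (C ×ˢ (D.K : Set G)),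
    (hC.prod D.isCompact_K).image (by fun_prop), fun b hb g ξ => ?_⟩
  obtain ⟨h, rfl⟩ := D.isOpenQuotientMap_plus.surjective ξ
  obtain ⟨k, hk, hkg⟩ := D.exists_H_mul_eq_add (g⁻¹ * h)
  refine ⟨(b, k), ⟨hb, hk⟩, ?_⟩
  rw [D.busemann_plus, mul_inv_rev, mul_assoc, hkg, add_sub_cancel_right]

lemma continuous_hopf : Continuous (hopf D) := by
  have hlift : hopf D ∘ D.toGM =
      fun g => (D.plus g, D.minus g, D.busemann (D.minus g) D.o (D.toX g)) :=
    funext D.hopf_toGM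
  rw [D.isOpenQuotientMap_toGM.isQuotientMap.continuous_iff, hlift]
  exact D.continuous_plus.prodMk (D.continuous_minus.prodMk
    (D.continuous_busemann_comp D.continuous_minus D.o D.isOpenQuotientMap_toX.continuous))

lemma continuous_bmsLogDensity (ψ₁ ψ₂ : Module.Dual ℝ D.𝔞) :
    Continuous (D.bmsLogDensity ψ₁ ψ₂) := by
  have hlift : D.bmsLogDensity ψ₁ ψ₂ ∘ D.toGM = fun g =>
      ψ₁ (D.busemann (D.plus g) D.o (D.toX g)) + ψ₂ (D.busemann (D.minus g) D.o (D.toX g)) :=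
    funext (D.bmsLogDensity_toGM ψ₁ ψ₂)
  have htoX := D.isOpenQuotientMap_toX.continuous
  rw [D.isOpenQuotientMap_toGM.isQuotientMap.continuous_iff, hlift]
  exact ((LinearMap.continuous_of_finiteDimensional ψ₁).comp
    (D.continuous_busemann_comp D.continuous_plus D.o htoX)).add
    ((LinearMap.continuous_of_finiteDimensional ψ₂).comp
      (D.continuous_busemann_comp D.continuous_minus D.o htoX))

lemma hopf_smul (g : G) (q : D.GM) : hopf D (g • q) = D.hopfAction g (hopf D q) := by
  obtain ⟨h, rfl⟩ := D.isOpenQuotientMap_toGM.surjective q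
  rw [smul_toGM, hopf_toGM, hopf_toGM, hopfAction, ← smul_toX, ← smul_plus, ← smul_minus,
    D.busemann_smul_eq_add]

lemma bmsLogDensity_smul (ψ₁ ψ₂ : Module.Dual ℝ D.𝔞) (g : G) (q : D.GM) :
    D.bmsLogDensity ψ₁ ψ₂ (g • q) = D.bmsLogDensity ψ₁ ψ₂ q +
      (ψ₁ (D.busemann (hopf D (g • q)).1 D.o (g • D.o)) +
        ψ₂ (D.busemann (hopf D (g • q)).2.1 D.o (g • D.o))) := by
  obtain ⟨h, rfl⟩ := D.isOpenQuotientMap_toGM.surjective q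
  rw [smul_toGM, bmsLogDensity_toGM, bmsLogDensity_toGM, hopf_toGM, ← smul_toX, ← smul_plus,
    ← smul_minus, D.busemann_smul_eq_add g (D.plus h) D.o (D.toX h),
    D.busemann_smul_eq_add g (D.minus h) D.o (D.toX h), map_add, map_add]
  ring

lemma hopfAction_hopfAction (g h : G) (p : D.F × D.F × D.𝔞) :
    D.hopfAction g (D.hopfAction h p) = D.hopfAction (g * h) p := by
  simp only [hopfAction, smul_smul, ← add_assoc]
  rw [← D.busemann_smul g (h • p.2.1) D.o, smul_smul, smul_smul, D.busemann_add]

lemma continuous_hopfAction (g : G) : Continuous (D.hopfAction g) := by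
  have hsnd : Continuous fun p : D.F × D.F × D.𝔞 => g • p.2.1 :=
    (continuous_fst.comp continuous_snd).const_smul g
  exact (continuous_fst.const_smul g).prodMk (hsnd.prodMk
    ((D.continuous_busemann_comp hsnd D.o continuous_const).add
      (continuous_snd.comp continuous_snd)))

end CartanData

section Comap

lemma image_preimage_of_semiconj {α β : Type*} {f : α → β} {e : α ≃ α} {T : β ≃ β}
    (h : Function.Semiconj f e T) (s : Set α) : f '' (e ⁻¹' s) = T ⁻¹' (f '' s) := by
  have hsymm : Function.Semiconj f e.symm T.symm := h.inverses_right e.right_inv T.left_inv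
  rw [← e.image_symm_eq_preimage, ← T.image_symm_eq_preimage, ← Set.image_comp, ← Set.image_comp,
    hsymm.comp_eq]

variable {α β : Type*} [MeasurableSpace α] [MeasurableSpace β] {f : α → β} {μ : Measure β}

-- `μ.comap f` is `0` by convention unless `f` is injective with null measurable images: the lemmas
-- below hold in that degenerate case as well.
lemma sFinite_comap (f : α → β) (μ : Measure β) [SFinite μ] : SFinite (μ.comap f) := by
  by_cases hf : Function.Injective f ∧ ∀ s, MeasurableSet s → NullMeasurableSet (f '' s) μ
  · have himage : ∀ i s, MeasurableSet s → NullMeasurableSet (f '' s) (sfiniteSeq μ i) :=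
      fun i s hs => (hf.2 s hs).mono (sfiniteSeq_le μ i)
    have hsum : μ.comap f = Measure.sum fun i => (sfiniteSeq μ i).comap f := by
      ext s hs
      rw [Measure.comap_apply₀ f μ hf.1 hf.2 hs.nullMeasurableSet, Measure.sum_apply _ hs]
      nth_rewrite 1 [← sum_sfiniteSeq μ]
      rw [Measure.sum_apply₀ _ (by rw [sum_sfiniteSeq]; exact hf.2 s hs)]
      exact tsum_congr fun i =>
        (Measure.comap_apply₀ f _ hf.1 (himage i) hs.nullMeasurableSet).symm
    have hfinite : ∀ i, IsFiniteMeasure ((sfiniteSeq μ i).comap f) := fun i =>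
      ⟨(Measure.comap_apply_le f _ MeasurableSet.univ.nullMeasurableSet).trans_lt
        (measure_lt_top _ _)⟩
    rw [hsum]
    infer_instance
  · rw [Measure.comap_undef hf]
    infer_instance

lemma map_comap_le (hf : Measurable f) : (μ.comap f).map f ≤ μ := by
  refine Measure.le_iff.2 fun s hs => ?_
  rw [Measure.map_apply hf hs]
  exact (Measure.comap_apply_le f μ (hf hs).nullMeasurableSet).trans
    (measure_mono (Set.image_preimage_subset f s))

lemma nullMeasurableSet_image_map_of_semiconj {e : α ≃ᵐ α} {T : β ≃ᵐ β}
    (h : Function.Semiconj f e T)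
    (hf : ∀ s, MeasurableSet s → NullMeasurableSet (f '' s) μ) {s : Set α} (hs : MeasurableSet s) :
    NullMeasurableSet (f '' s) (μ.map T) := by
  have himage : f '' s = T.symm ⁻¹' (f '' (e ⁻¹' s)) :=
    ((congrArg (T.symm ⁻¹' ·)
      (image_preimage_of_semiconj (e := e.toEquiv) (T := T.toEquiv) h s)).trans
        (T.toEquiv.symm_preimage_preimage _)).symm
  rw [himage]
  refine (hf _ (e.measurable hs)).preimage ⟨T.symm.measurable, ?_⟩
  rw [T.map_symm_map]

lemma map_comap_of_semiconj {e : α ≃ᵐ α} {T : β ≃ᵐ β} (h : Function.Semiconj f e T) :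
    (μ.comap f).map e = (μ.map T).comap f := by
  by_cases hf : Function.Injective f ∧ ∀ s, MeasurableSet s → NullMeasurableSet (f '' s) μ
  · ext s hs
    rw [e.map_apply, Measure.comap_apply₀ f μ hf.1 hf.2 (e.measurable hs).nullMeasurableSet,
      Measure.comap_apply₀ f _ hf.1 (fun s => nullMeasurableSet_image_map_of_semiconj h hf.2)
        hs.nullMeasurableSet, T.map_apply]
    exact congrArg μ (image_preimage_of_semiconj (e := e.toEquiv) (T := T.toEquiv) h s)
  · have hsymm : Function.Semiconj f e.symm T.symm :=
      h.inverses_right e.right_inv T.left_inv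
    have hf' : ¬ (Function.Injective f ∧
        ∀ s, MeasurableSet s → NullMeasurableSet (f '' s) (μ.map T)) := fun hmap =>
      hf ⟨hmap.1, fun s hs => by
        simpa only [MeasurableEquiv.map_symm_map] using
          nullMeasurableSet_image_map_of_semiconj hsymm hmap.2 hs⟩
    rw [Measure.comap_undef hf, Measure.comap_undef hf', Measure.map_zero]

lemma restrict_comap_map (hf : Measurable f) (hinj : Function.Injective f)
    (himage : ∀ s, MeasurableSet s → NullMeasurableSet (f '' s) μ) {s : Set α}
    (hs : MeasurableSet s) : ((μ.comap f).restrict s).map f = μ.restrict (f '' s) := by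
  ext t ht
  rw [Measure.map_apply hf ht, Measure.restrict_apply (hf ht), Measure.restrict_apply ht,
    Measure.comap_apply₀ f μ hinj himage ((hf ht).inter hs).nullMeasurableSet,
    Set.image_preimage_inter]

lemma comap_withDensity (hf : Measurable f) {J : β → ℝ≥0∞} (hJ : Measurable J)
    (hJ0 : ∀ y, J y ≠ 0) : (μ.withDensity J).comap f = (μ.comap f).withDensity (J ∘ f) := by
  by_cases h : Function.Injective f ∧ ∀ s, MeasurableSet s → NullMeasurableSet (f '' s) μ
  · have h' : ∀ s, MeasurableSet s → NullMeasurableSet (f '' s) (μ.withDensity J) :=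
      fun s hs => (h.2 s hs).mono_ac (withDensity_absolutelyContinuous μ J)
    ext s hs
    rw [Measure.comap_apply₀ f _ h.1 h' hs.nullMeasurableSet, withDensity_apply _ hs,
      withDensity_apply₀ _ (h.2 s hs), ← restrict_comap_map hf h.1 h.2 hs, lintegral_map hJ hf]
    rfl
  · have h' : ¬ (Function.Injective f ∧
        ∀ s, MeasurableSet s → NullMeasurableSet (f '' s) (μ.withDensity J)) := fun h' =>
      h ⟨h'.1, fun s hs => (h'.2 s hs).mono_ac (withDensity_absolutelyContinuous' hJ.aemeasurable
        (Eventually.of_forall hJ0))⟩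
    rw [Measure.comap_undef h, Measure.comap_undef h', withDensity_zero_left]

end Comap

namespace LeftQuot

variable {Γ Y : Type*} [Group Γ] [MulAction Γ Y]

variable (Γ Y) in
lemma continuous_mk [TopologicalSpace Y] : Continuous (LeftQuot.mk Γ : Y → LeftQuot Γ Y) :=
  continuous_quotient_mk'

variable (Γ Y) in
lemma measurable_mk [TopologicalSpace Y] [MeasurableSpace Y] [BorelSpace Y] :
    Measurable (LeftQuot.mk Γ : Y → LeftQuot Γ Y) :=
  (continuous_mk Γ Y).measurable

lemma mk_eq_mk {x y : Y} : LeftQuot.mk Γ x = LeftQuot.mk Γ y ↔ ∃ γ : Γ, γ • y = x :=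
  Quotient.eq (r := MulAction.orbitRel Γ Y)

lemma mk_smul (γ : Γ) (y : Y) : LeftQuot.mk Γ (γ • y) = LeftQuot.mk Γ y :=
  mk_eq_mk.2 ⟨γ, rfl⟩

end LeftQuot

section Transversal

lemma exists_measurable_injective_real (X : Type*) [MeasurableSpace X]
    [MeasurableSpace.CountablySeparated X] : ∃ φ : X → ℝ, Measurable φ ∧ Function.Injective φ := by
  obtain ⟨f, hf, hinj⟩ := MeasurableSpace.measurable_injection_nat_bool_of_countablySeparated X
  have hemb := measurableEmbedding_embeddingReal (ℕ → Bool)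
  exact ⟨embeddingReal (ℕ → Bool) ∘ f, hemb.measurable.comp hf, hemb.injective.comp hinj⟩

variable {Γ X : Type*} [Group Γ] [Countable Γ] [MulAction Γ X] [MeasurableSpace X]

/- An orbit meets `U` in finitely many points: choose the one with the least label, for an arbitrary
measurable labelling of `X` by real numbers. -/
lemma exists_measurableSet_injOn_mk_of_finite [MeasurableConstSMul Γ X]
    [MeasurableSpace.CountablySeparated X] {U : Set X} (hU : MeasurableSet U)
    (hfin : ∀ x, {γ : Γ | γ • x ∈ U}.Finite) :
    ∃ F : Set X, MeasurableSet F ∧ Set.InjOn (LeftQuot.mk Γ) F ∧ ∀ x ∈ U, ∃ γ : Γ, γ • x ∈ F := by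
  obtain ⟨φ, hφ, hinj⟩ := exists_measurable_injective_real X
  have hmeas (γ : Γ) : MeasurableSet {x | γ • x ∈ U → φ x ≤ φ (γ • x)} :=
    (measurable_const_smul γ hU).imp
      (measurableSet_le hφ (hφ.comp (measurable_const_smul γ)))
  refine ⟨{x | x ∈ U ∧ ∀ γ : Γ, γ • x ∈ U → φ x ≤ φ (γ • x)}, ?_, ?_, fun x hx => ?_⟩
  · have hiInter := MeasurableSet.iInter hmeas
    rw [← Set.ofPred_forall] at hiInter
    exact hU.inter hiInter
  · rintro x ⟨hx, hxmin⟩ y ⟨hy, hymin⟩ hxy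
    obtain ⟨γ, rfl⟩ := LeftQuot.mk_eq_mk.1 hxy
    have hle := hxmin γ⁻¹
    rw [inv_smul_smul] at hle
    exact hinj (le_antisymm (hle hy) (hymin γ hx))
  · obtain ⟨γ, hγ, hmin⟩ := (hfin x).exists_minimalFor (fun γ : Γ => φ (γ • x)) _
      ⟨1, by simpa using hx⟩
    refine ⟨γ, hγ, fun γ' hγ' => ?_⟩
    rw [smul_smul] at hγ' ⊢
    exact le_of_not_gt fun hlt => (hmin hγ' hlt.le).not_gt hlt

lemma exists_measurableSet_injOn_mk_of_iUnion [MeasurableConstSMul Γ X] {F : ℕ → Set X}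
    (hF : ∀ i, MeasurableSet (F i)) (hinj : ∀ i, Set.InjOn (LeftQuot.mk Γ) (F i))
    (hcov : ∀ x, ∃ i, ∃ γ : Γ, γ • x ∈ F i) :
    ∃ F : Set X, MeasurableSet F ∧ Set.InjOn (LeftQuot.mk Γ) F ∧ ∀ x, ∃ γ : Γ, γ • x ∈ F := by
  classical
  refine ⟨⋃ i, F i \ ⋃ j ∈ Set.Iio i, ⋃ γ : Γ, (γ • ·) ⁻¹' F j, ?_, ?_, fun x => ?_⟩
  · exact MeasurableSet.iUnion fun i => (hF i).diff <| MeasurableSet.biUnion (Set.to_countable _)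
      fun j _ => MeasurableSet.iUnion fun γ => measurable_const_smul γ (hF j)
  · intro x hx y hy hxy
    obtain ⟨γ, rfl⟩ := LeftQuot.mk_eq_mk.1 hxy
    obtain ⟨i, hi, hi'⟩ := Set.mem_iUnion.1 hx
    obtain ⟨j, hj, hj'⟩ := Set.mem_iUnion.1 hy
    rcases lt_trichotomy i j with hij | rfl | hij
    · exact (hj' (Set.mem_biUnion hij (Set.mem_iUnion.2 ⟨γ, hi⟩))).elim
    · exact hinj i hi hj hxy
    · exact (hi' (Set.mem_biUnion hij (Set.mem_iUnion.2 ⟨γ⁻¹, by simpa using hj⟩))).elim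
  · obtain ⟨γ, hγ⟩ := Nat.find_spec (hcov x)
    refine ⟨γ, Set.mem_iUnion.2 ⟨Nat.find (hcov x), hγ, fun hmem => ?_⟩⟩
    obtain ⟨j, hj, hjF⟩ := Set.mem_iUnion₂.1 hmem
    obtain ⟨γ', hγ'⟩ := Set.mem_iUnion.1 hjF
    exact Nat.find_min (hcov x) hj ⟨γ' * γ, by simpa [mul_smul] using hγ'⟩

lemma exists_measurableSet_injOn_mk (Γ X : Type*) [Group Γ] [Countable Γ] [MulAction Γ X]
    [TopologicalSpace X] [MeasurableSpace X] [BorelSpace X] [SecondCountableTopology X]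
    [T2Space X] [SigmaCompactSpace X] [ContinuousConstSMul Γ X] [ProperlyDiscontinuousSMul Γ X] :
    ∃ F : Set X, MeasurableSet F ∧ Set.InjOn (LeftQuot.mk Γ) F ∧ ∀ x, ∃ γ : Γ, γ • x ∈ F := by
  have hcompact := isCompact_compactCovering X
  have hlocal (i : ℕ) := exists_measurableSet_injOn_mk_of_finite (Γ := Γ)
    (hcompact i).measurableSet fun x =>
      (ProperlyDiscontinuousSMul.finite_disjoint_inter_image (Γ := Γ)
        (isCompact_singleton (x := x)) (hcompact i)).subset fun γ hγ =>
          ⟨γ • x, Set.mem_image_of_mem _ rfl, hγ⟩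
  choose F hF hinj hcov using hlocal
  refine exists_measurableSet_injOn_mk_of_iUnion hF hinj fun x => ?_
  obtain ⟨i, hi⟩ := exists_mem_compactCovering x
  exact ⟨i, hcov i x hi⟩

end Transversal

section Unfolding

lemma setLIntegral_mk_le_inducedMeasure {Γ Y : Type*} [Group Γ] [MulAction Γ Y]
    [TopologicalSpace Y] [MeasurableSpace Y] [BorelSpace Y] {μ : Measure Y} {F : Set Y}
    (hF : MeasurableSet F) (hinj : Set.InjOn (LeftQuot.mk Γ) F) {f : LeftQuot Γ Y → ℝ≥0∞}
    (hf : Measurable f) :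
    ∫⁻ y in F, f (LeftQuot.mk Γ y) ∂μ ≤ ∫⁻ p, f p ∂inducedMeasure Γ μ := by
  rw [← lintegral_map hf (LeftQuot.measurable_mk Γ Y)]
  exact lintegral_mono' (le_iSup (fun B : {B : Set Y // MeasurableSet B ∧
    Set.InjOn (LeftQuot.mk Γ) B} => (μ.restrict B.1).map (LeftQuot.mk Γ)) ⟨F, hF, hinj⟩) le_rfl

lemma lintegral_le_lintegral_tsum_smul {Γ X : Type*} [Group Γ] [Countable Γ] [MulAction Γ X]
    [MeasurableSpace X] [MeasurableConstSMul Γ X] {vol : Measure X} [SMulInvariantMeasure Γ X vol]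
    {F : Set X} (hF : MeasurableSet F) (hcov : ∀ x, ∃ γ : Γ, γ • x ∈ F) {φ : X → ℝ≥0∞}
    (hφ : Measurable φ) :
    ∫⁻ x, φ x ∂vol ≤ ∫⁻ x in F, ∑' γ : Γ, φ (γ⁻¹ • x) ∂vol := by
  have hpre : (⋃ γ : Γ, (γ • ·) ⁻¹' F) = Set.univ :=
    Set.eq_univ_of_forall fun x => Set.mem_iUnion.2 (hcov x)
  calc ∫⁻ x, φ x ∂vol
      = ∫⁻ x in ⋃ γ : Γ, (γ • ·) ⁻¹' F, φ x ∂vol := by rw [hpre, setLIntegral_univ]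
    _ ≤ ∑' γ : Γ, ∫⁻ x in (γ • ·) ⁻¹' F, φ x ∂vol := lintegral_iUnion_le _ _
    _ = ∑' γ : Γ, ∫⁻ x in F, φ (γ⁻¹ • x) ∂vol := tsum_congr fun γ => by
        simpa only [Function.comp_def, inv_smul_smul] using
          (measurePreserving_smul γ vol).setLIntegral_comp_preimage hF
            (hφ.comp (measurable_const_smul γ⁻¹))
    _ = ∫⁻ x in F, ∑' γ : Γ, φ (γ⁻¹ • x) ∂vol :=
        (lintegral_tsum fun γ => (hφ.comp (measurable_const_smul γ⁻¹)).aemeasurable).symm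

variable {G X : Type*} [Group G] [TopologicalSpace G] [IsTopologicalGroup G]
  [TopologicalSpace X] [MulAction G X] [ContinuousSMul G X]

lemma isOpen_inv_smul_mem {V : Set X} (hV : IsOpen V) :
    IsOpen {p : G × X | p.1⁻¹ • p.2 ∈ V} :=
  hV.preimage (continuous_fst.inv.smul continuous_snd)

variable [MeasurableSpace G] [BorelSpace G]

lemma tsum_measure_le_measure_mk_mem {Γ : Subgroup G} [Countable Γ] {μ : Measure G}
    [SMulInvariantMeasure Γ G μ] {V : Set X} (hV : IsOpen V) {A : Set G} (hA : MeasurableSet A)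
    (hinj : Set.InjOn (LeftQuot.mk Γ) A) {S : Set (LeftQuot Γ G)}
    (hAS : A ⊆ LeftQuot.mk Γ ⁻¹' S) (x : X) :
    ∑' γ : Γ, μ {g | g ∈ A ∧ g⁻¹ • γ⁻¹ • x ∈ V} ≤ μ {g | LeftQuot.mk Γ g ∈ S ∧ g⁻¹ • x ∈ V} := by
  have hVx : MeasurableSet {g : G | g⁻¹ • x ∈ V} :=
    (hV.preimage (continuous_inv.smul continuous_const)).measurableSet
  let A' (γ : Γ) : Set G := {g | γ⁻¹ • g ∈ A ∧ g⁻¹ • x ∈ V}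
  have hA' (γ : Γ) : MeasurableSet (A' γ) := (measurable_const_smul γ⁻¹ hA).inter hVx
  have htranslate (γ : Γ) : μ {g | g ∈ A ∧ g⁻¹ • γ⁻¹ • x ∈ V} = μ (A' γ) := by
    rw [← measure_preimage_smul μ γ (A' γ)]
    simp only [A', Set.preimage_ofPred_eq, inv_smul_smul]
    simp only [Subgroup.smul_def, smul_eq_mul, mul_inv_rev, mul_smul, InvMemClass.coe_inv]
  have hdisjoint : Pairwise (Function.onFun Disjoint A') := fun γ γ' hne => by
    refine Set.disjoint_left.2 ?_
    rintro g ⟨hg, -⟩ ⟨hg', -⟩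
    have hmk : γ⁻¹ • g = γ'⁻¹ • g :=
      hinj hg hg' (by rw [LeftQuot.mk_smul, LeftQuot.mk_smul])
    exact hne (inv_injective (Subtype.ext (mul_right_cancel hmk)))
  rw [tsum_congr htranslate, ← measure_iUnion hdisjoint hA']
  refine measure_mono (Set.iUnion_subset fun γ g hg => ⟨?_, hg.2⟩)
  rw [← LeftQuot.mk_smul γ⁻¹ g]
  exact hAS hg.1

variable [SecondCountableTopology X] [MeasurableSpace X] [BorelSpace X] {vol : Measure X}
  [SFinite vol] [SMulInvariantMeasure G X vol] {μ : Measure G} [SFinite μ]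

lemma lintegral_measure_inv_smul_mem {V : Set X} (hV : IsOpen V) {A : Set G}
    (hA : MeasurableSet A) :
    ∫⁻ x, μ {g | g ∈ A ∧ g⁻¹ • x ∈ V} ∂vol = vol V * μ A := by
  let S : Set (G × X) := {p | p.1 ∈ A ∧ p.1⁻¹ • p.2 ∈ V}
  have hS : MeasurableSet S := (measurable_fst hA).inter (isOpen_inv_smul_mem hV).measurableSet
  have hslice (g : G) : vol (Prod.mk g ⁻¹' S) = A.indicator (fun _ => vol V) g := by
    by_cases hg : g ∈ A
    · rw [Set.indicator_of_mem hg, ← measure_preimage_smul vol g⁻¹ V]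
      simp only [S, hg, true_and, Set.preimage_ofPred_eq]
      rfl
    · simp [S, hg]
  calc ∫⁻ x, μ {g | g ∈ A ∧ g⁻¹ • x ∈ V} ∂vol
      = μ.prod vol S := (Measure.prod_apply_symm hS).symm
    _ = ∫⁻ g, A.indicator (fun _ => vol V) g ∂μ := by
        rw [Measure.prod_apply hS, lintegral_congr hslice]
    _ = vol V * μ A := by rw [lintegral_indicator hA, setLIntegral_const]

variable {Γ : Subgroup G} [Countable Γ] [SMulInvariantMeasure Γ G μ]

lemma measure_mul_le_lintegral_of_injOn_mk {V : Set X} (hV : IsOpen V) {F : Set X}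
    (hF : MeasurableSet F) (hcov : ∀ x : X, ∃ γ : Γ, γ • x ∈ F) {A : Set G} (hA : MeasurableSet A)
    (hinj : Set.InjOn (LeftQuot.mk Γ) A) {S : Set (LeftQuot Γ G)}
    (hAS : A ⊆ LeftQuot.mk Γ ⁻¹' S) :
    vol V * μ A ≤ ∫⁻ x in F, μ {g | LeftQuot.mk Γ g ∈ S ∧ g⁻¹ • x ∈ V} ∂vol := by
  have hmeas : Measurable fun x => μ {g | g ∈ A ∧ g⁻¹ • x ∈ V} :=
    measurable_measure_prodMk_right (μ := μ) (s := {p : G × X | p.1 ∈ A ∧ p.1⁻¹ • p.2 ∈ V})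
      ((measurable_fst hA).inter (isOpen_inv_smul_mem hV).measurableSet)
  rw [← lintegral_measure_inv_smul_mem hV hA]
  exact (lintegral_le_lintegral_tsum_smul hF hcov hmeas).trans
    (lintegral_mono fun x => tsum_measure_le_measure_mk_mem hV hA hinj hAS x)

lemma measure_mul_inducedMeasure_le_lintegral {V : Set X} (hV : IsOpen V) (hV0 : vol V ≠ 0)
    (hVtop : vol V ≠ ∞) {F : Set X} (hF : MeasurableSet F)
    (hcov : ∀ x : X, ∃ γ : Γ, γ • x ∈ F) {S : Set (LeftQuot Γ G)} (hS : MeasurableSet S) :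
    vol V * inducedMeasure Γ μ S ≤
      ∫⁻ x in F, μ {g | LeftQuot.mk Γ g ∈ S ∧ g⁻¹ • x ∈ V} ∂vol := by
  have hmk : Measurable (LeftQuot.mk Γ : G → LeftQuot Γ G) := LeftQuot.measurable_mk Γ G
  have hmk_snd : Measurable fun p : G × X => LeftQuot.mk Γ p.1 := hmk.comp measurable_fst
  let Z : Set (G × X) := {p | p.1⁻¹ • p.2 ∈ V}
  let R : Measure (LeftQuot Γ G) :=
    ((μ.prod (vol.restrict F)).restrict Z).map fun p => LeftQuot.mk Γ p.1
  have hR {T : Set (LeftQuot Γ G)} (hT : MeasurableSet T) :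
      R T = ∫⁻ x in F, μ {g | LeftQuot.mk Γ g ∈ T ∧ g⁻¹ • x ∈ V} ∂vol := by
    rw [Measure.map_apply hmk_snd hT, Measure.restrict_apply (hmk_snd hT),
      Measure.prod_apply_symm ((hmk_snd hT).inter (isOpen_inv_smul_mem hV).measurableSet)]
    rfl
  have hle : inducedMeasure Γ μ ≤ (vol V)⁻¹ • R := by
    refine iSup_le fun ⟨B, hB, hBinj⟩ => Measure.le_iff.2 fun T hT => ?_
    have hunfold := measure_mul_le_lintegral_of_injOn_mk (vol := vol) (μ := μ) hV hF hcov
      ((hmk hT).inter hB) (hBinj.mono Set.inter_subset_right) Set.inter_subset_left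
    rwa [Measure.map_apply hmk hT, Measure.restrict_apply (hmk hT), Measure.smul_apply,
      smul_eq_mul, hR hT, mul_comm, ← div_eq_mul_inv,
      ENNReal.le_div_iff_mul_le (Or.inl hV0) (Or.inl hVtop), mul_comm]
  calc vol V * inducedMeasure Γ μ S ≤ vol V * ((vol V)⁻¹ * R S) := by
        gcongr
        exact hle S
    _ = R S := by rw [← mul_assoc, ENNReal.mul_inv_cancel hV0 hVtop, one_mul]
    _ = _ := hR hS

end Unfolding

instance : PolishSpace (Matrix (Fin n) (Fin n) ℝ) :=
  inferInstanceAs (PolishSpace (Fin n → Fin n → ℝ))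

instance : LocallyCompactSpace (Matrix (Fin n) (Fin n) ℝ) :=
  inferInstanceAs (LocallyCompactSpace (Fin n → Fin n → ℝ))

instance : SecondCountableTopology (Matrix (Fin n) (Fin n) ℝ) :=
  inferInstanceAs (SecondCountableTopology (Fin n → Fin n → ℝ))

instance : PolishSpace (GL (Fin n) ℝ) :=
  have := (isOpenEmbedding_val_GL (n := n)).isOpen_range.polishSpace
  isOpenEmbedding_val_GL.isEmbedding.toHomeomorph.isClosedEmbedding.polishSpace

instance : LocallyCompactSpace (GL (Fin n) ℝ) := isOpenEmbedding_val_GL.locallyCompactSpace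

instance : SecondCountableTopology G := TopologicalSpace.Subtype.secondCountableTopology _

instance [hG : Fact (IsClosed (G : Set (GL (Fin n) ℝ)))] : PolishSpace G :=
  hG.out.isClosedEmbedding_subtypeVal.polishSpace

instance [hG : Fact (IsClosed (G : Set (GL (Fin n) ℝ)))] : LocallyCompactSpace G :=
  hG.out.isClosedEmbedding_subtypeVal.locallyCompactSpace

instance : SecondCountableTopology (lieAlg G) :=
  TopologicalSpace.Subtype.secondCountableTopology _

instance {Γ Y : Type*} [Group Γ] [MulAction Γ Y] [TopologicalSpace Y] [ContinuousConstSMul Γ Y]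
    [SecondCountableTopology Y] : SecondCountableTopology (LeftQuot Γ Y) :=
  ContinuousConstSMul.secondCountableTopology (Γ := Γ) (T := Y)

namespace CartanData

variable (D : CartanData G)

instance : SecondCountableTopology D.X := inferInstanceAs (SecondCountableTopology (G ⧸ D.K))
instance : SecondCountableTopology D.F := inferInstanceAs (SecondCountableTopology (G ⧸ D.P))
instance : SecondCountableTopology D.GM := inferInstanceAs (SecondCountableTopology (G ⧸ D.M))
instance : SecondCountableTopology D.𝔞 := TopologicalSpace.Subtype.secondCountableTopology _

instance : ContinuousSMul G D.X := inferInstanceAs (ContinuousSMul G (G ⧸ D.K))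
instance : MulAction.IsPretransitive G D.X :=
  inferInstanceAs (MulAction.IsPretransitive G (G ⧸ D.K))

instance : T2Space D.X :=
  have : IsClosed (D.K : Set G) := D.isCompact_K.isClosed
  inferInstanceAs (T2Space (G ⧸ D.K))

instance : T2Space D.GM :=
  have : IsClosed (D.M : Set G) :=
    (isCompact_iff_compactSpace.mpr (inferInstanceAs (CompactSpace D.M))).isClosed
  inferInstanceAs (T2Space (G ⧸ D.M))

instance [LocallyCompactSpace G] : LocallyCompactSpace D.X :=
  inferInstanceAs (LocallyCompactSpace (G ⧸ D.K))

instance : LocallyCompactSpace D.𝔞 := .of_finiteDimensional_of_complete ℝ _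

lemma isProperMap_toX : IsProperMap D.toX := by
  refine isProperMap_iff_isClosedMap_and_compact_fibers.2
    ⟨D.isOpenQuotientMap_toX.continuous, QuotientGroup.isClosedMap_coe D.isCompact_K, fun x => ?_⟩
  obtain ⟨g, rfl⟩ := D.isOpenQuotientMap_toX.surjective x
  have hfiber : D.toX ⁻¹' {D.toX g} = (g * ·) '' (D.K : Set G) := by
    ext h
    rw [Set.image_mul_left, Set.mem_preimage, Set.mem_preimage, Set.mem_singleton_iff, eq_comm]
    exact QuotientGroup.eq
  rw [hfiber]
  exact D.isCompact_K.image (continuous_const_mul g)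

instance {Γ : Subgroup G} [DiscreteTopology Γ] : ProperlyDiscontinuousSMul Γ D.X := by
  refine ⟨fun {L L'} hL hL' => ?_⟩
  have hC := D.isProperMap_toX.isCompact_preimage hL
  have hC' := D.isProperMap_toX.isCompact_preimage hL'
  have hfinite := Subgroup.tendsto_coe_cofinite_of_discrete Γ
    (isDiscrete_iff_discreteTopology.mpr ‹_›) (hC'.mul hC.inv).compl_mem_cocompact
  rw [mem_map, mem_cofinite, ← Set.preimage_compl, compl_compl] at hfinite
  refine hfinite.subset ?_
  rintro γ ⟨_, ⟨x, hx, rfl⟩, hγx⟩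
  obtain ⟨c, rfl⟩ := D.isOpenQuotientMap_toX.surjective x
  exact ⟨γ * c, hγx, c⁻¹, by simpa using hx, mul_inv_cancel_right _ _⟩

lemma measure_pos_of_isOpen [LocallyCompactSpace G] {vol : Measure D.X}
    [IsFiniteMeasureOnCompacts vol] [SMulInvariantMeasure G D.X vol] (hvol : vol ≠ 0) {V : Set D.X}
    (hV : IsOpen V) (hne : V.Nonempty) : 0 < vol V :=
  have := TopologicalSpace.metrizableSpace_of_t3_secondCountable D.X
  letI := TopologicalSpace.metrizableSpaceMetric D.X
  measure_isOpen_pos_of_smulInvariant_of_ne_zero G hvol hV hne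

end CartanData

section ConformalDensity

variable {D : CartanData G} {Γ : Subgroup G} {ψ ψ₁ ψ₂ : Module.Dual ℝ D.𝔞}

/-- The density `e^{ψ(β_ξ(o, x))}` of `ν_x` with respect to `ν_o`, for a `(Γ, ψ)`-conformal
density `ν`. -/
def conformalFactor (ψ : Module.Dual ℝ D.𝔞) (x : D.X) (ξ : D.F) : ℝ≥0∞ :=
  ENNReal.ofReal (Real.exp (ψ (D.busemann ξ D.o x)))

lemma ConformalDensity.meas_eq (ν : ConformalDensity D Γ ψ) (x : D.X) :
    ν.meas x = (ν.meas D.o).withDensity (conformalFactor ψ x) := by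
  rw [ν.density x D.o]
  congr 1
  ext ξ
  rw [conformalFactor, ← map_neg, D.neg_busemann]

lemma ConformalDensity.E_mk (ν : ConformalDensity D Γ ψ) (x : D.X) :
    ν.E (LeftQuot.mk Γ x) = ∫⁻ ξ, conformalFactor ψ x ξ ∂ν.meas D.o := by
  change ν.meas x Set.univ = _
  rw [ν.meas_eq x, withDensity_apply _ MeasurableSet.univ, Measure.restrict_univ]

variable [Fact (IsClosed (G : Set (GL (Fin n) ℝ)))] [ConnectedSpace G]

lemma continuous_conformalFactor (ψ : Module.Dual ℝ D.𝔞) :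
    Continuous fun p : D.F × D.X => conformalFactor ψ p.2 p.1 :=
  ENNReal.continuous_ofReal.comp (Real.continuous_exp.comp
    ((LinearMap.continuous_of_finiteDimensional ψ).comp (D.continuous_busemann D.o)))

lemma measurable_conformalFactor (ψ : Module.Dual ℝ D.𝔞) (x : D.X) :
    Measurable (conformalFactor ψ x) :=
  ((continuous_conformalFactor ψ).comp (Continuous.prodMk_left x)).measurable

/- Joint measurability gives measurability of `x ↦ |ν_x|` on `X`. It descends to `Γ\X` because
a Borel surjection from a Polish space onto a second countable Hausdorff space detects
measurability. -/
lemma ConformalDensity.measurable_E [DiscreteTopology Γ] (ν : ConformalDensity D Γ ψ) :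
    Measurable ν.E := by
  have : T2Space (LeftQuot Γ D.X) :=
    inferInstanceAs (T2Space (Quotient (MulAction.orbitRel Γ D.X)))
  have := ν.finite D.o
  have htoX := D.isOpenQuotientMap_toX
  have hproj : Measurable fun g : G => LeftQuot.mk Γ (D.toX g) :=
    ((LeftQuot.continuous_mk Γ D.X).comp htoX.continuous).measurable
  have hsurj : Function.Surjective fun g : G => LeftQuot.mk Γ (D.toX g) :=
    (Quotient.mk_surjective (s := MulAction.orbitRel Γ D.X)).comp htoX.surjective
  have hlift : ν.E ∘ (fun g : G => LeftQuot.mk Γ (D.toX g)) =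
      fun g => ∫⁻ ξ, conformalFactor ψ (D.toX g) ξ ∂ν.meas D.o := funext fun g => ν.E_mk _
  rw [← hproj.measurable_comp_iff_of_surjective hsurj, hlift]
  exact Measurable.lintegral_prod_right' (f := fun p : G × D.F => conformalFactor ψ (D.toX p.1) p.2)
    ((continuous_conformalFactor ψ).comp
      (continuous_snd.prodMk (htoX.continuous.comp continuous_fst))).measurable

lemma ConformalDensity.lintegral_smul (ν : ConformalDensity D Γ ψ) (γ : Γ) {f : D.F → ℝ≥0∞}
    (hf : Measurable f) :
    ∫⁻ ξ, f ((γ : G) • ξ) ∂ν.meas D.o =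
      ∫⁻ ξ, conformalFactor ψ ((γ : G) • D.o) ξ * f ξ ∂ν.meas D.o := by
  rw [← lintegral_map hf (measurable_const_smul (γ : G)), ν.equivariant γ D.o,
    ν.meas_eq ((γ : G) • D.o),
    lintegral_withDensity_eq_lintegral_mul _ (measurable_conformalFactor ψ _) hf]
  rfl

lemma lintegral_lintegral_smul_smul (ν : ConformalDensity D Γ ψ₁) (ν' : ConformalDensity D Γ ψ₂)
    (γ : Γ) {f : D.F × D.F → ℝ≥0∞} (hf : Measurable f) :
    ∫⁻ ξ, ∫⁻ η, f ((γ : G) • ξ, (γ : G) • η) ∂ν'.meas D.o ∂ν.meas D.o =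
      ∫⁻ ξ, ∫⁻ η, conformalFactor ψ₁ ((γ : G) • D.o) ξ *
        (conformalFactor ψ₂ ((γ : G) • D.o) η * f (ξ, η)) ∂ν'.meas D.o ∂ν.meas D.o := by
  have := ν'.finite D.o
  have hfactor := measurable_conformalFactor ψ₂ ((γ : G) • D.o)
  have hweighted : Measurable fun p : D.F × D.F =>
      conformalFactor ψ₂ ((γ : G) • D.o) p.2 * f p := (hfactor.comp measurable_snd).mul hf
  have hinner (ξ : D.F) := ν'.lintegral_smul γ (hf.comp (measurable_prodMk_left (x := ξ)))
  simp only [Function.comp_def] at hinner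
  simp_rw [hinner]
  rw [ν.lintegral_smul γ hweighted.lintegral_prod_right']
  exact lintegral_congr fun ξ =>
    (lintegral_const_mul _ (hweighted.comp measurable_prodMk_left)).symm

end ConformalDensity

section HopfMeasure

variable {D : CartanData G} {Γ : Subgroup G} {ψ₁ ψ₂ : Module.Dual ℝ D.𝔞} {ℓ : Measure D.𝔞}
  {ν : ConformalDensity D Γ ψ₁} {ν' : ConformalDensity D Γ ψ₂}

/-- The measure `ν_o ⊗ ν̄_o ⊗ dv` in Hopf coordinates. -/
def hopfMeasure (ℓ : Measure D.𝔞) (ν : ConformalDensity D Γ ψ₁) (ν' : ConformalDensity D Γ ψ₂) :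
    Measure (D.F × D.F × D.𝔞) :=
  (ν.meas D.o).prod ((ν'.meas D.o).prod ℓ)

/-- The density of `ν_x ⊗ ν̄_x ⊗ dv` with respect to `ν_o ⊗ ν̄_o ⊗ dv`. For `x = γ o` it is the
Jacobian of the action of `γ` in Hopf coordinates. -/
def hopfJacobian (ψ₁ ψ₂ : Module.Dual ℝ D.𝔞) (x : D.X) (p : D.F × D.F × D.𝔞) : ℝ≥0∞ :=
  conformalFactor ψ₁ x p.1 * conformalFactor ψ₂ x p.2.1

/-- The density on `G/M` defining the Bowen-Margulis-Sullivan measure. -/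
def bmsDensity (ψ₁ ψ₂ : Module.Dual ℝ D.𝔞) (q : D.GM) : ℝ≥0∞ :=
  ENNReal.ofReal (Real.exp (D.bmsLogDensity ψ₁ ψ₂ q))

lemma bmsGM_eq : bmsGM ℓ ν ν' =
    ((hopfMeasure ℓ ν ν').comap (hopf D)).withDensity (bmsDensity ψ₁ ψ₂) := rfl

lemma hopfJacobian_ne_zero (x : D.X) (p : D.F × D.F × D.𝔞) : hopfJacobian ψ₁ ψ₂ x p ≠ 0 :=
  mul_ne_zero (ENNReal.ofReal_pos.2 (Real.exp_pos _)).ne'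
    (ENNReal.ofReal_pos.2 (Real.exp_pos _)).ne'

lemma lintegral_hopfMeasure [SFinite ℓ] {f : D.F × D.F × D.𝔞 → ℝ≥0∞} (hf : Measurable f) :
    ∫⁻ p, f p ∂hopfMeasure ℓ ν ν' =
      ∫⁻ ξ, ∫⁻ η, ∫⁻ v, f (ξ, η, v) ∂ℓ ∂ν'.meas D.o ∂ν.meas D.o := by
  have := ν.finite D.o
  have := ν'.finite D.o
  rw [hopfMeasure, lintegral_prod _ hf.aemeasurable]
  exact lintegral_congr fun ξ =>
    lintegral_prod (fun y => f (ξ, y)) (hf.comp measurable_prodMk_left).aemeasurable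

instance [SFinite ℓ] : SFinite (bmsGM ℓ ν ν') := by
  have := ν.finite D.o
  have := ν'.finite D.o
  have : SFinite (hopfMeasure ℓ ν ν') := inferInstanceAs (SFinite (Measure.prod _ _))
  have := sFinite_comap (hopf D) (hopfMeasure ℓ ν ν')
  rw [bmsGM_eq]
  infer_instance

lemma map_withDensity_eq_self {α : Type*} [MeasurableSpace α] {τ : Measure α} {e : α ≃ᵐ α}
    {J ρ : α → ℝ≥0∞} (hJ : Measurable J) (hρ : Measurable ρ) (hτ : τ.map e = τ.withDensity J)
    (hρe : ∀ a, ρ (e a) = J (e a) * ρ a) : (τ.withDensity ρ).map e = τ.withDensity ρ := by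
  refine Measure.ext_of_lintegral _ fun f hf => ?_
  have hρ_symm : Measurable fun a => ρ (e.symm a) := hρ.comp e.symm.measurable
  calc ∫⁻ a, f a ∂(τ.withDensity ρ).map e
      = ∫⁻ a, ρ (e.symm (e a)) * f (e a) ∂τ := by
        simp only [lintegral_map_equiv, e.symm_apply_apply]
        exact lintegral_withDensity_eq_lintegral_mul _ hρ (hf.comp e.measurable)
    _ = ∫⁻ a, ρ (e.symm a) * f a ∂τ.withDensity J := by
        rw [← hτ, lintegral_map_equiv (fun a => ρ (e.symm a) * f a)]
    _ = ∫⁻ a, J a * (ρ (e.symm a) * f a) ∂τ :=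
        lintegral_withDensity_eq_lintegral_mul _ hJ (hρ_symm.mul hf)
    _ = ∫⁻ a, ρ a * f a ∂τ := by
        refine lintegral_congr fun a => ?_
        rw [← mul_assoc, ← congrArg J (e.apply_symm_apply a), ← hρe, e.apply_symm_apply]
    _ = ∫⁻ a, f a ∂τ.withDensity ρ := (lintegral_withDensity_eq_lintegral_mul _ hρ hf).symm

variable [Fact (IsClosed (G : Set (GL (Fin n) ℝ)))] [ConnectedSpace G]

lemma measurable_hopfJacobian (ψ₁ ψ₂ : Module.Dual ℝ D.𝔞) (x : D.X) :
    Measurable (hopfJacobian ψ₁ ψ₂ x) :=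
  ((measurable_conformalFactor ψ₁ x).comp measurable_fst).mul
    ((measurable_conformalFactor ψ₂ x).comp (measurable_fst.comp measurable_snd))

lemma measurable_bmsDensity (ψ₁ ψ₂ : Module.Dual ℝ D.𝔞) : Measurable (bmsDensity ψ₁ ψ₂) :=
  (ENNReal.continuous_ofReal.comp
    (Real.continuous_exp.comp (D.continuous_bmsLogDensity ψ₁ ψ₂))).measurable

lemma bmsDensity_smul (ψ₁ ψ₂ : Module.Dual ℝ D.𝔞) (g : G) (q : D.GM) :
    bmsDensity ψ₁ ψ₂ (g • q) =
      hopfJacobian ψ₁ ψ₂ (g • D.o) (hopf D (g • q)) * bmsDensity ψ₁ ψ₂ q := by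
  rw [bmsDensity, bmsDensity, hopfJacobian, conformalFactor, conformalFactor,
    D.bmsLogDensity_smul, add_comm, Real.exp_add, Real.exp_add,
    ENNReal.ofReal_mul (by positivity), ENNReal.ofReal_mul (by positivity)]

/-- The action of `g` in Hopf coordinates as a measurable equivalence. -/
def hopfEquiv (D : CartanData G) (g : G) : (D.F × D.F × D.𝔞) ≃ᵐ (D.F × D.F × D.𝔞) where
  toFun := D.hopfAction g
  invFun := D.hopfAction g⁻¹
  left_inv p := by rw [D.hopfAction_hopfAction, inv_mul_cancel, D.hopfAction_one]
  right_inv p := by rw [D.hopfAction_hopfAction, mul_inv_cancel, D.hopfAction_one]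
  measurable_toFun := (D.continuous_hopfAction g).measurable
  measurable_invFun := (D.continuous_hopfAction g⁻¹).measurable

variable [SFinite ℓ] [ℓ.IsAddLeftInvariant]

lemma lintegral_hopfAction (γ : Γ) {f : D.F × D.F × D.𝔞 → ℝ≥0∞} (hf : Measurable f) :
    ∫⁻ p, f (D.hopfAction γ p) ∂hopfMeasure ℓ ν ν' =
      ∫⁻ p, hopfJacobian ψ₁ ψ₂ ((γ : G) • D.o) p * f p ∂hopfMeasure ℓ ν ν' := by
  have htranslate (ξ η : D.F) : ∫⁻ v, f (D.hopfAction γ (ξ, η, v)) ∂ℓ =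
      ∫⁻ v, f ((γ : G) • ξ, (γ : G) • η, v) ∂ℓ :=
    lintegral_add_left_eq_self (μ := ℓ) (fun v => f ((γ : G) • ξ, (γ : G) • η, v))
      (D.busemann ((γ : G) • η) D.o ((γ : G) • D.o))
  have hfibre : Measurable fun q : D.F × D.F => ∫⁻ v, f (q.1, q.2, v) ∂ℓ :=
    Measurable.lintegral_prod_right' (f := fun r : (D.F × D.F) × D.𝔞 => f (r.1.1, r.1.2, r.2))
      (hf.comp (by fun_prop))
  rw [lintegral_hopfMeasure (f := fun p => f (D.hopfAction γ p))
      (hf.comp (D.continuous_hopfAction γ).measurable),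
    lintegral_hopfMeasure (f := fun p => hopfJacobian ψ₁ ψ₂ ((γ : G) • D.o) p * f p)
      ((measurable_hopfJacobian ψ₁ ψ₂ _).mul hf)]
  simp_rw [htranslate]
  rw [lintegral_lintegral_smul_smul ν ν' γ hfibre]
  refine lintegral_congr fun ξ => lintegral_congr fun η => ?_
  rw [← mul_assoc]
  exact (lintegral_const_mul _ (hf.comp measurable_prodMk_left |>.comp measurable_prodMk_left)).symm

lemma map_hopfEquiv (γ : Γ) : (hopfMeasure ℓ ν ν').map (hopfEquiv D γ) =
    (hopfMeasure ℓ ν ν').withDensity (hopfJacobian ψ₁ ψ₂ ((γ : G) • D.o)) := by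
  refine Measure.ext_of_lintegral _ fun f hf => ?_
  rw [lintegral_map_equiv,
    lintegral_withDensity_eq_lintegral_mul _ (measurable_hopfJacobian ψ₁ ψ₂ _) hf]
  exact lintegral_hopfAction γ hf

lemma map_smul_bmsGM (γ : Γ) : (bmsGM ℓ ν ν').map ((γ : G) • ·) = bmsGM ℓ ν ν' := by
  have hhopf : Measurable (hopf D) := D.continuous_hopf.measurable
  have hJ := measurable_hopfJacobian ψ₁ ψ₂ ((γ : G) • D.o)
  have hsemiconj : Function.Semiconj (hopf D) (MeasurableEquiv.smul (γ : G)) (hopfEquiv D γ) :=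
    D.hopf_smul γ
  have hτ : ((hopfMeasure ℓ ν ν').comap (hopf D)).map (MeasurableEquiv.smul (γ : G)) =
      ((hopfMeasure ℓ ν ν').comap (hopf D)).withDensity
        (hopfJacobian ψ₁ ψ₂ ((γ : G) • D.o) ∘ hopf D) := by
    rw [map_comap_of_semiconj hsemiconj, map_hopfEquiv,
      comap_withDensity hhopf hJ (hopfJacobian_ne_zero _)]
  exact map_withDensity_eq_self (hJ.comp hhopf) (measurable_bmsDensity ψ₁ ψ₂) hτ
    (bmsDensity_smul ψ₁ ψ₂ (γ : G))

end HopfMeasure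

section FibreMeasure

variable {D : CartanData G}

/-- The Haar probability measure of `M`. -/
def haarM (D : CartanData G) : Measure D.M :=
  Measure.haarMeasure (⊤ : TopologicalSpace.PositiveCompacts D.M)

instance : (haarM D).IsMulLeftInvariant :=
  inferInstanceAs (Measure.haarMeasure _).IsMulLeftInvariant

instance : IsProbabilityMeasure (haarM D) := ⟨Measure.haarMeasure_self⟩

/-- The Haar probability measure on the fibre of `G → G/M` over `q`. -/
def fibreMeasure (D : CartanData G) (q : D.GM) : Measure G :=
  (haarM D).map fun m : D.M => D.repGM q * (m : G)

lemma fibreMeasure_toGM (g : G) :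
    fibreMeasure D (D.toGM g) = (haarM D).map fun m : D.M => g * (m : G) := by
  obtain ⟨m₀, hm₀⟩ := D.exists_repGM_eq g
  have hmul : Measurable fun m : D.M => g * (m : G) := by fun_prop
  rw [fibreMeasure, hm₀]
  conv_rhs => rw [← map_mul_left_eq_self (haarM D) m₀]
  rw [Measure.map_map hmul (measurable_const_mul m₀)]
  simp only [Function.comp_def, Subgroup.coe_mul, mul_assoc]

instance (q : D.GM) : IsProbabilityMeasure (fibreMeasure D q) :=
  Measure.isProbabilityMeasure_map (Measurable.aemeasurable (by fun_prop))

lemma fibreMeasure_eq_zero {s : Set G} (hs : MeasurableSet s) {q : D.GM} (hq : q ∉ D.toGM '' s) :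
    fibreMeasure D q s = 0 := by
  rw [fibreMeasure, Measure.map_apply (by fun_prop) hs]
  refine measure_mono_null (fun m hm => (hq ⟨_, hm, ?_⟩).elim) measure_empty
  rw [D.toGM_mul_M _ m.2, D.toGM_repGM]

lemma fibreMeasure_smul (g : G) (q : D.GM) {s : Set G} (hs : MeasurableSet s) :
    fibreMeasure D (g • q) s = fibreMeasure D q ((g * ·) ⁻¹' s) := by
  obtain ⟨h, rfl⟩ := D.isOpenQuotientMap_toGM.surjective q
  rw [D.smul_toGM, fibreMeasure_toGM, fibreMeasure_toGM, Measure.map_apply (by fun_prop) hs,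
    Measure.map_apply (by fun_prop) (measurable_const_mul g hs)]
  simp only [← Set.preimage_comp, Function.comp_def, mul_assoc]

variable [Fact (IsClosed (G : Set (GL (Fin n) ℝ)))]

lemma measurable_fibreMeasure (D : CartanData G) : Measurable (fibreMeasure D) := by
  rw [← D.isOpenQuotientMap_toGM.continuous.measurable.measurable_comp_iff_of_surjective
    D.isOpenQuotientMap_toGM.surjective]
  refine Measure.measurable_of_measurable_coe _ fun s hs => ?_
  have hslice (g : G) : (fibreMeasure D ∘ D.toGM) g s =
      haarM D (Prod.mk g ⁻¹' ((fun p : G × D.M => p.1 * (p.2 : G)) ⁻¹' s)) := by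
    rw [Function.comp_apply, fibreMeasure_toGM, Measure.map_apply (by fun_prop) hs]
    rfl
  simp_rw [hslice]
  exact measurable_measure_prodMk_left ((by fun_prop : Measurable _) hs)

variable {Γ : Subgroup G} {ψ₁ ψ₂ : Module.Dual ℝ D.𝔞} {ℓ : Measure D.𝔞}
  {ν : ConformalDensity D Γ ψ₁} {ν' : ConformalDensity D Γ ψ₂}

lemma bmsG_apply {s : Set G} (hs : MeasurableSet s) :
    bmsG ℓ ν ν' s = ∫⁻ q, fibreMeasure D q s ∂bmsGM ℓ ν ν' :=
  Measure.bind_apply hs (measurable_fibreMeasure D).aemeasurable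

instance [SFinite ℓ] : SFinite (bmsG ℓ ν ν') :=
  let κ : ProbabilityTheory.Kernel D.GM G := ⟨fibreMeasure D, measurable_fibreMeasure D⟩
  have : ProbabilityTheory.IsMarkovKernel κ := ⟨fun q => inferInstanceAs
    (IsProbabilityMeasure (fibreMeasure D q))⟩
  inferInstanceAs (SFinite ((bmsGM ℓ ν ν').bind κ))

instance [ConnectedSpace G] [SFinite ℓ] [ℓ.IsAddLeftInvariant] :
    SMulInvariantMeasure Γ G (bmsG ℓ ν ν') where
  measure_preimage_smul γ s hs := by
    calc bmsG ℓ ν ν' ((γ • ·) ⁻¹' s)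
        = ∫⁻ q, fibreMeasure D ((γ : G) • q) s ∂bmsGM ℓ ν ν' := by
          simp_rw [fibreMeasure_smul _ _ hs]
          exact bmsG_apply (measurable_const_mul (γ : G) hs)
      _ = ∫⁻ q, fibreMeasure D q s ∂(bmsGM ℓ ν ν').map ((γ : G) • ·) :=
          (lintegral_map ((Measure.measurable_coe hs).comp (measurable_fibreMeasure D))
            (measurable_const_smul (γ : G))).symm
      _ = bmsG ℓ ν ν' s := by rw [map_smul_bmsGM, bmsG_apply hs]

end FibreMeasure

section Smearing

variable {D : CartanData G} {Γ : Subgroup G} {ψ₁ ψ₂ : Module.Dual ℝ D.𝔞} {ℓ : Measure D.𝔞}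
  {ν : ConformalDensity D Γ ψ₁} {ν' : ConformalDensity D Γ ψ₂} {V : Set D.X} {L : Set D.𝔞}
  {c₁ c₂ : ℝ}

/-- An upper bound, in Hopf coordinates, for the part of the Bowen-Margulis-Sullivan measure
carried by the flats passing near `x`: the points of such a flat near `x` have their Busemann
value relative to `x` in the fixed set `L`. -/
def nearDensity (ψ₁ ψ₂ : Module.Dual ℝ D.𝔞) (L : Set D.𝔞) (x : D.X) (p : D.F × D.F × D.𝔞) :
    ℝ≥0∞ :=
  hopfJacobian ψ₁ ψ₂ x p * L.indicator 1 (-D.busemann p.2.1 D.o x + p.2.2)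

lemma bmsDensity_le_nearDensity (h₁ : ∀ v ∈ L, ψ₁ v ≤ c₁) (h₂ : ∀ v ∈ L, ψ₂ v ≤ c₂) {x : D.X}
    {g : G} (hx : ∀ ξ, D.busemann ξ x (D.toX g) ∈ L) :
    bmsDensity ψ₁ ψ₂ (D.toGM g) ≤
      ENNReal.ofReal (Real.exp (c₁ + c₂)) * nearDensity ψ₁ ψ₂ L x (hopf D (D.toGM g)) := by
  have hplus := D.busemann_add (D.plus g) D.o x (D.toX g)
  have hminus := D.busemann_add (D.minus g) D.o x (D.toX g)
  rw [bmsDensity, nearDensity, hopfJacobian, D.hopf_toGM, D.bmsLogDensity_toGM]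
  simp only
  rw [← hminus, neg_add_cancel_left, Set.indicator_of_mem (hx _), Pi.one_apply, mul_one,
    conformalFactor, conformalFactor, ← ENNReal.ofReal_mul (Real.exp_nonneg _), ← Real.exp_add,
    ← ENNReal.ofReal_mul (Real.exp_nonneg _), ← Real.exp_add, ← hplus, map_add, map_add]
  refine ENNReal.ofReal_le_ofReal (Real.exp_le_exp.2 ?_)
  linarith [h₁ _ (hx (D.plus g)), h₂ _ (hx (D.minus g))]

lemma bmsDensity_mul_fibreMeasure_le (hV : IsOpen V) (h₁ : ∀ v ∈ L, ψ₁ v ≤ c₁)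
    (h₂ : ∀ v ∈ L, ψ₂ v ≤ c₂) {x : D.X}
    (hVL : ∀ g : G, g⁻¹ • x ∈ V → ∀ ξ, D.busemann ξ x (D.toX g) ∈ L) (q : D.GM) :
    bmsDensity ψ₁ ψ₂ q * fibreMeasure D q {g | g⁻¹ • x ∈ V} ≤
      ENNReal.ofReal (Real.exp (c₁ + c₂)) * nearDensity ψ₁ ψ₂ L x (hopf D q) := by
  have hnear : IsOpen {g : G | g⁻¹ • x ∈ V} := hV.preimage (continuous_inv.smul continuous_const)
  by_cases hq : q ∈ D.toGM '' {g : G | g⁻¹ • x ∈ V}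
  · obtain ⟨g, hg, rfl⟩ := hq
    exact (mul_le_of_le_one_right' prob_le_one).trans (bmsDensity_le_nearDensity h₁ h₂ (hVL g hg))
  · rw [fibreMeasure_eq_zero hnear.measurableSet hq, mul_zero]
    exact zero_le

lemma mk_mem_oneNeighborhood {S : Set (LeftQuot Γ G)} {x : D.X} {g : G}
    (hg : LeftQuot.mk Γ g ∈ S) (hx : D.dist x (D.toX g) < 1) :
    LeftQuot.mk Γ x ∈ oneNeighborhood D Γ S :=
  ⟨x, g, rfl, hg, hx⟩

lemma isOpen_image_mk_setOf_exists_inv_smul_mem (hV : IsOpen V) (S : Set (LeftQuot Γ G)) :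
    IsOpen (LeftQuot.mk Γ '' {x : D.X | ∃ g : G, LeftQuot.mk Γ g ∈ S ∧ g⁻¹ • x ∈ V}) := by
  have hunion : {x : D.X | ∃ g : G, LeftQuot.mk Γ g ∈ S ∧ g⁻¹ • x ∈ V} =
      ⋃ g ∈ LeftQuot.mk Γ ⁻¹' S, (fun x : D.X => g⁻¹ • x) ⁻¹' V := by
    ext x
    simp
  rw [hunion]
  exact isOpenMap_quotient_mk'_mul (Γ := Γ) (T := D.X) _
    (isOpen_biUnion fun g _ => hV.preimage (continuous_const_smul _))

variable [Fact (IsClosed (G : Set (GL (Fin n) ℝ)))] [ConnectedSpace G]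

lemma measurable_nearDensity (ψ₁ ψ₂ : Module.Dual ℝ D.𝔞) (hL : MeasurableSet L) (x : D.X) :
    Measurable (nearDensity ψ₁ ψ₂ L x) := by
  have hβ : Continuous fun p : D.F × D.F × D.𝔞 => D.busemann p.2.1 D.o x :=
    D.continuous_busemann_comp (continuous_fst.comp continuous_snd) D.o continuous_const
  exact (measurable_hopfJacobian ψ₁ ψ₂ x).mul ((measurable_one.indicator hL).comp
    (hβ.neg.add (continuous_snd.comp continuous_snd)).measurable)

lemma lintegral_nearDensity [SFinite ℓ] [ℓ.IsAddLeftInvariant] (hL : MeasurableSet L) (x : D.X) :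
    ∫⁻ p, nearDensity ψ₁ ψ₂ L x p ∂hopfMeasure ℓ ν ν' =
      ν.E (LeftQuot.mk Γ x) * ν'.E (LeftQuot.mk Γ x) * ℓ L := by
  have hflat (ξ η : D.F) : ∫⁻ v, nearDensity ψ₁ ψ₂ L x (ξ, η, v) ∂ℓ =
      conformalFactor ψ₁ x ξ * (conformalFactor ψ₂ x η * ℓ L) := by
    simp only [nearDensity, hopfJacobian]
    rw [lintegral_const_mul _ (f := fun v => L.indicator 1 (-D.busemann η D.o x + v))
        ((measurable_one.indicator hL).comp (measurable_const_add _)),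
      lintegral_add_left_eq_self (fun v => L.indicator 1 v), lintegral_indicator_one hL, mul_assoc]
  have hfactor₁ := measurable_conformalFactor ψ₁ x
  have hfactor₂ := measurable_conformalFactor ψ₂ x
  rw [lintegral_hopfMeasure (measurable_nearDensity ψ₁ ψ₂ hL x)]
  simp_rw [hflat, lintegral_const_mul _ (hfactor₂.mul_const (ℓ L)), lintegral_mul_const _ hfactor₂,
    lintegral_mul_const _ hfactor₁, ← ν'.E_mk, ← ν.E_mk, mul_assoc]

lemma bmsG_inv_smul_mem_le [SFinite ℓ] [ℓ.IsAddLeftInvariant] (hV : IsOpen V)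
    (hL : MeasurableSet L) (h₁ : ∀ v ∈ L, ψ₁ v ≤ c₁) (h₂ : ∀ v ∈ L, ψ₂ v ≤ c₂) {x : D.X}
    (hVL : ∀ g : G, g⁻¹ • x ∈ V → ∀ ξ, D.busemann ξ x (D.toX g) ∈ L) :
    bmsG ℓ ν ν' {g | g⁻¹ • x ∈ V} ≤ ENNReal.ofReal (Real.exp (c₁ + c₂)) * ℓ L *
      (ν.E (LeftQuot.mk Γ x) * ν'.E (LeftQuot.mk Γ x)) := by
  have hnear : MeasurableSet {g : G | g⁻¹ • x ∈ V} :=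
    (hV.preimage (continuous_inv.smul continuous_const)).measurableSet
  have hhopf : Measurable (hopf D) := D.continuous_hopf.measurable
  have hdensity := measurable_nearDensity ψ₁ ψ₂ hL x
  set κ := ENNReal.ofReal (Real.exp (c₁ + c₂))
  calc bmsG ℓ ν ν' {g | g⁻¹ • x ∈ V}
      = ∫⁻ q, bmsDensity ψ₁ ψ₂ q * fibreMeasure D q {g | g⁻¹ • x ∈ V}
          ∂(hopfMeasure ℓ ν ν').comap (hopf D) := by
        rw [bmsG_apply hnear, bmsGM_eq]
        exact lintegral_withDensity_eq_lintegral_mul _ (measurable_bmsDensity ψ₁ ψ₂)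
          ((Measure.measurable_coe hnear).comp (measurable_fibreMeasure D))
    _ ≤ ∫⁻ q, κ * nearDensity ψ₁ ψ₂ L x (hopf D q) ∂(hopfMeasure ℓ ν ν').comap (hopf D) :=
        lintegral_mono (bmsDensity_mul_fibreMeasure_le hV h₁ h₂ hVL)
    _ = ∫⁻ p, κ * nearDensity ψ₁ ψ₂ L x p ∂((hopfMeasure ℓ ν ν').comap (hopf D)).map (hopf D) :=
        (lintegral_map (hdensity.const_mul _) hhopf).symm
    _ ≤ ∫⁻ p, κ * nearDensity ψ₁ ψ₂ L x p ∂hopfMeasure ℓ ν ν' :=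
        lintegral_mono' (map_comap_le hhopf) le_rfl
    _ = κ * ℓ L * (ν.E (LeftQuot.mk Γ x) * ν'.E (LeftQuot.mk Γ x)) := by
        rw [lintegral_const_mul _ hdensity, lintegral_nearDensity hL x]
        ring

lemma exists_isOpen_dist_lt_one_busemann_mem (D : CartanData G) :
    ∃ (V Z : Set D.X) (L : Set D.𝔞), IsOpen V ∧ V.Nonempty ∧ V ⊆ Z ∧ IsCompact Z ∧ IsCompact L ∧
      ∀ (x : D.X) (g : G), g⁻¹ • x ∈ V →
        D.dist x (D.toX g) < 1 ∧ ∀ ξ, D.busemann ξ x (D.toX g) ∈ L := by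
  obtain ⟨B, C, hB, hB1, hBC, hC, hdist⟩ := D.exists_nhds_dist_lt_one
  obtain ⟨L, hL, hCL⟩ := D.exists_isCompact_busemann_mem hC
  refine ⟨D.toX '' B, D.toX '' C, L, D.isOpenQuotientMap_toX.isOpenMap _ hB, ⟨_, 1, hB1, rfl⟩,
    Set.image_mono hBC, hC.image D.isOpenQuotientMap_toX.continuous, hL, ?_⟩
  rintro x g ⟨b, hb, hgb⟩
  obtain rfl : x = D.toX (g * b) := by rw [← D.smul_toX, hgb, smul_inv_smul]
  exact ⟨hdist b hb g, hCL b (hBC hb) g⟩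

variable [DiscreteTopology Γ] {vol : Measure D.X} [SFinite vol] [SMulInvariantMeasure G D.X vol]
  {κ : ℝ≥0∞} [SFinite ℓ] [ℓ.IsAddLeftInvariant]

lemma measure_mul_bms_univ_le (hV : IsOpen V) (hV0 : vol V ≠ 0) (hVtop : vol V ≠ ∞)
    (hdist : ∀ (x : D.X) (g : G), g⁻¹ • x ∈ V → D.dist x (D.toX g) < 1)
    (hκ : ∀ x : D.X, bmsG ℓ ν ν' {g | g⁻¹ • x ∈ V} ≤
      κ * (ν.E (LeftQuot.mk Γ x) * ν'.E (LeftQuot.mk Γ x))) :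
    vol V * bms ℓ ν ν' Set.univ ≤
      κ * ∫⁻ p in oneNeighborhood D Γ (bms ℓ ν ν').support, ν.E p * ν'.E p
        ∂inducedMeasure Γ vol := by
  have : Countable Γ := TopologicalSpace.separableSpace_iff_countable.1 inferInstance
  have := SecondCountableTopology.toHereditarilyLindelof (X := LeftQuot Γ G)
  obtain ⟨F, hF, hinj, hcov⟩ := exists_measurableSet_injOn_mk Γ D.X
  set S := (bms ℓ ν ν').support
  let U := LeftQuot.mk Γ '' {x : D.X | ∃ g : G, LeftQuot.mk Γ g ∈ S ∧ g⁻¹ • x ∈ V}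
  have hU : MeasurableSet U := (isOpen_image_mk_setOf_exists_inv_smul_mem hV S).measurableSet
  have hUS : U ⊆ oneNeighborhood D Γ S := by
    rintro _ ⟨x, ⟨g, hg, hx⟩, rfl⟩
    exact mk_mem_oneNeighborhood hg (hdist x g hx)
  have hE : Measurable fun p => ν.E p * ν'.E p := ν.measurable_E.mul ν'.measurable_E
  have hslice (x : D.X) : bmsG ℓ ν ν' {g | LeftQuot.mk Γ g ∈ S ∧ g⁻¹ • x ∈ V} ≤
      U.indicator (fun p => κ * (ν.E p * ν'.E p)) (LeftQuot.mk Γ x) := by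
    by_cases hx : LeftQuot.mk Γ x ∈ U
    · rw [Set.indicator_of_mem hx]
      exact (measure_mono fun g hg => hg.2).trans (hκ x)
    · rw [Set.indicator_of_notMem hx]
      exact (measure_mono_null (fun g hg => hx ⟨x, ⟨g, hg⟩, rfl⟩) measure_empty).le
  calc vol V * bms ℓ ν ν' Set.univ
      = vol V * bms ℓ ν ν' S := by
        rw [← measure_congr (eventuallyEq_univ.2 Measure.support_mem_ae)]
    _ ≤ ∫⁻ x in F, bmsG ℓ ν ν' {g | LeftQuot.mk Γ g ∈ S ∧ g⁻¹ • x ∈ V} ∂vol :=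
        measure_mul_inducedMeasure_le_lintegral hV hV0 hVtop hF hcov
          Measure.isClosed_support.measurableSet
    _ ≤ ∫⁻ x in F, U.indicator (fun p => κ * (ν.E p * ν'.E p)) (LeftQuot.mk Γ x) ∂vol :=
        lintegral_mono hslice
    _ ≤ ∫⁻ p, U.indicator (fun p => κ * (ν.E p * ν'.E p)) p ∂inducedMeasure Γ vol :=
        setLIntegral_mk_le_inducedMeasure hF hinj ((hE.const_mul κ).indicator hU)
    _ = κ * ∫⁻ p in U, ν.E p * ν'.E p ∂inducedMeasure Γ vol := by
        rw [lintegral_indicator hU, lintegral_const_mul _ hE]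
    _ ≤ κ * ∫⁻ p in oneNeighborhood D Γ S, ν.E p * ν'.E p ∂inducedMeasure Γ vol := by
        gcongr

end Smearing

end Smearing

end

open Smearing

theorem mainTheorem6_general {n : ℕ} {G : Subgroup (GL (Fin n) ℝ)}
    (hclosed : IsClosed (G : Set (GL (Fin n) ℝ))) (hconn : ConnectedSpace G)
    (D : CartanData G) (ℓ : Measure D.𝔞) [ℓ.IsAddHaarMeasure]
    (vol : Measure D.X) [IsFiniteMeasureOnCompacts vol] (hvol : vol ≠ 0)
    (hinv : ∀ g : G, vol.map (fun x => g • x) = vol) (ψ₁ ψ₂ : Module.Dual ℝ D.𝔞) :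
    ∃ c : ℝ, 0 < c ∧ ∀ (Γ : Subgroup G) [DiscreteTopology Γ]
      (ν : ConformalDensity D Γ ψ₁) (ν' : ConformalDensity D Γ ψ₂),
      bms ℓ ν ν' Set.univ ≤ ENNReal.ofReal c *
        ∫⁻ x in oneNeighborhood D Γ (bms ℓ ν ν').support,
          ν.E x * ν'.E x ∂inducedMeasure Γ vol := by
  have : Fact (IsClosed (G : Set (GL (Fin n) ℝ))) := ⟨hclosed⟩
  have : SMulInvariantMeasure G D.X vol := ((smulInvariantMeasure_tfae G vol).out 5 0).1 hinv
  obtain ⟨V, Z, L, hV, hVne, hVZ, hZ, hL, hnear⟩ := exists_isOpen_dist_lt_one_busemann_mem D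
  obtain ⟨c₁, hc₁⟩ := hL.bddAbove_image ψ₁.continuous_of_finiteDimensional.continuousOn
  obtain ⟨c₂, hc₂⟩ := hL.bddAbove_image ψ₂.continuous_of_finiteDimensional.continuousOn
  have hV0 : vol V ≠ 0 := (D.measure_pos_of_isOpen hvol hV hVne).ne'
  have hVtop : vol V ≠ ∞ := ((measure_mono hVZ).trans_lt hZ.measure_lt_top).ne
  let κ : ℝ≥0∞ := ENNReal.ofReal (Real.exp (c₁ + c₂)) * ℓ L
  have hκtop : κ ≠ ∞ := ENNReal.mul_ne_top ENNReal.ofReal_ne_top hL.measure_lt_top.ne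
  have hκV : κ / vol V ≠ ∞ := ENNReal.div_ne_top hκtop hV0
  refine ⟨(κ / vol V).toReal + 1, by positivity, fun Γ _ ν ν' => ?_⟩
  have hκ (x : D.X) : bmsG ℓ ν ν' {g | g⁻¹ • x ∈ V} ≤
      κ * (ν.E (LeftQuot.mk Γ x) * ν'.E (LeftQuot.mk Γ x)) :=
    bmsG_inv_smul_mem_le hV hL.measurableSet (fun v hv => hc₁ ⟨v, hv, rfl⟩)
      (fun v hv => hc₂ ⟨v, hv, rfl⟩) fun g hg => (hnear x g hg).2
  have hsmear := measure_mul_bms_univ_le hV hV0 hVtop (fun x g hg => (hnear x g hg).1) hκ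
  rw [mul_comm, ← ENNReal.le_div_iff_mul_le (.inl hV0) (.inl hVtop),
    ENNReal.mul_div_right_comm] at hsmear
  refine hsmear.trans (mul_le_mul_left ?_ _)
  rw [ENNReal.ofReal_add ENNReal.toReal_nonneg zero_le_one, ENNReal.ofReal_toReal hκV]
  exact le_self_add

theorem mainTheorem6 {n : ℕ} (G : Subgroup (GL (Fin n) ℝ))
    (hG : Smearing.IsConnectedSemisimpleAlgebraic G) (D : Smearing.CartanData G)
    (Γ : Subgroup G) (hΓ : DiscreteTopology Γ) (hΓ' : ∀ γ : Γ, IsOfFinOrder γ → γ = 1)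
    -- a Lebesgue measure on `𝔞`, in any normalization
    (ℓ : Measure D.𝔞) (hℓ : ℓ.IsAddHaarMeasure)
    -- the Riemannian volume of `X`, in any normalization: a nonzero `G`-invariant Radon measure
    (vol : Measure D.X) (hvol : vol ≠ 0) (hvol' : IsFiniteMeasureOnCompacts vol)
    (hvol'' : ∀ g : G, vol.map (fun x => g • x) = vol)
    (ψ₁ ψ₂ : Module.Dual ℝ D.𝔞)
    (ν : Smearing.ConformalDensity D Γ ψ₁) (ν' : Smearing.ConformalDensity D Γ ψ₂) :
    ∃ c : ℝ, 0 < c ∧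
      Smearing.bms ℓ ν ν' Set.univ ≤ ENNReal.ofReal c *
        ∫⁻ x in Smearing.oneNeighborhood D Γ (Smearing.bms ℓ ν ν').support,
          ν.E x * ν'.E x ∂(Smearing.inducedMeasure Γ vol) := by
  obtain ⟨c, hc, hbound⟩ :=
    mainTheorem6_general hG.isClosed hG.connectedSpace D ℓ vol hvol hvol'' ψ₁ ψ₂
  exact ⟨c, hc, hbound Γ ν ν'⟩
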